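/- Algebras are associative complex algebras, not necessarily unital. For algebras $A_1,A_2$ let $A_1\sqcup A_2$ be their free product (the coproduct of algebras, as a vector space the direct sum of all alternating tensor products of $A_1$ and $A_2$), with embeddings $i_1,i_2$; for algebra homomorphisms $j_k$ write $j_1\sqcup j_2$ for the homomorphism on $A_1\sqcup A_2$ determined by $j_1, j_2$ (common target), and $j_1\amalg j_2=(i_1\circ j_1)\sqcup(i_2\circ j_2)$. A $\odot$-independence assigns to every pair of linear functionals $\phi_k:A_k\to\mathbb C$ a linear functional $\phi_1\odot\phi_2$ on $A_1\sqcup A_2$ such that $(\phi_1\odot\phi_2)\circ i_k=\phi_k$ for $k=1,2$, $(\phi_1\odot\phi_2)\odot\phi_3=\phi_1\odot(\phi_2\odot\phi_3)$, and $(\phi_1\circ j_1)\odot(\phi_2\circ j_2)=(\phi_1\odot\phi_2)\circ(j_1\amalg j_2)$ for all algebra homomorphisms $j_1,j_2$. Fix a $\odot$-independence. A dual semigroup is a $*$-algebra $B$ with a $*$-homomorphism $\Delta:B\to B\sqcup B$ such that $(\Delta\amalg\mathrm{id})\circ\Delta=(\mathrm{id}\amalg\Delta)\circ\Delta$ and $(0\sqcup\mathrm{id})\circ\Delta=\mathrm{id}=(\mathrm{id}\sqcup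 0)\circ\Delta$. For linear functionals on $B$ put $\phi_1\star_\Delta\phi_2=(\phi_1\odot\phi_2)\circ\Delta$. Let $S(B)$ be the (unital) symmetric algebra over $B$, with embedding $i:B\to S(B)$, and let $S(\phi):S(B)\to\mathbb C$ be the character extending a linear functional $\phi$. There is a unique linear map $\sigma:B\sqcup B\to S(B)\otimes S(B)$ with $\phi_1\odot\phi_2=(S(\phi_1)\otimes S(\phi_2))\circ\sigma$ for all $\phi_1,\phi_2$. Give $S(B)$ the comultiplication extending $\sigma\circ\Delta$ to an algebra homomorphism, and the counit $S(0)$. For a linear functional $\psi$ on $B$ let $D(\psi)(c)=\frac{d}{dt}S(t\psi)(c)|_{t=0}$ and $$\exp_{\star\Delta}\psi=\Bigl(\sum_{n\ge 0}\tfrac{1}{n!}D(\psi)^{\star n}\Bigr)\circ i ,$$ the series being pointwise convergent on $S(B)$. Let $T(B)=\bigoplus_{n\ge1}B^{\otimes n}$ be the tensor $*$-algebra over the $*$-vector space $B$, with embedding $i_B:B\to T(B)$. Let $T(\Delta):T(B)\to T(B)\sqcup T(B)$ be the homomorphism extending the linear map $(i_B\sqcup i_B)\circ\Delta$, where $i_B\sqcup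 i_B:B\sqcup B\to T(B)\sqcup T(B)$ is the linear map applying $i_B$ to each letter of an alternating tensor. Let $M:T(B)\to B$ be the multiplication map, $M(b_1\otimes\cdots\otimes b_n)=b_1\cdots b_n$. The convolution and the convolution exponential on $T(B)$ are formed in the same way with $T(\Delta)$ in place of $\Delta$. Then for all linear functionals $\phi_1,\phi_2,\psi$ on a dual semigroup $(B,\Delta)$: (a) $(\phi_1\circ M)\star_{T(\Delta)}(\phi_2\circ M)=(\phi_1\star_\Delta\phi_2)\circ M$; (b) $\exp_{\star\Delta}\psi$ and $\exp_{\star T(\Delta)}(\psi\circ M)$ are well defined, and $\exp_{\star T(\Delta)}(\psi\circ M)=(\exp_{\star\Delta}\psi)\circ M$; (c) $\ker M$ is a two-sided $*$-ideal of $T(B)$, and $\exp_{\star T(\Delta)}(\psi\circ M)$ vanishes on $\ker M$. -/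

import Mathlib

open scoped TensorProduct

universe u w

noncomputable section

namespace DualSemi

/-! ### Augmentation ideals as non-unital algebras -/

section Aug

variable {U : Type u} [Ring U] [Algebra ℂ U]

/-- The kernel of a character of a unital algebra, as a non-unital algebra. -/
def augKer (ε : U →ₐ[ℂ] ℂ) : NonUnitalSubalgebra ℂ U where
  carrier := {x | ε x = 0}
  add_mem' {x y} hx hy := by
    have hx' : ε x = 0 := hx
    have hy' : ε y = 0 := hy
    simp [hx', hy']
  zero_mem' := by simp
  mul_mem' {x y} hx _ := by
    have hx' : ε x = 0 := hx
    simp [hx']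
  smul_mem' c {x} hx := by
    have hx' : ε x = 0 := hx
    simp [hx']

variable {A : Type w} [NonUnitalRing A] [Module ℂ A] [IsScalarTower ℂ A A] [SMulCommClass ℂ A A]

/-- A unital homomorphism into the unitization of `A` restricts to a homomorphism from the
augmentation ideal into `A`. -/
def augLift (ε : U →ₐ[ℂ] ℂ) (F : U →ₐ[ℂ] Unitization ℂ A) (hF : ∀ x, (F x).fst = ε x) :
    augKer ε →ₙₐ[ℂ] A where
  toFun x := (F x.1).snd
  map_smul' c x := by simp
  map_zero' := by simp
  map_add' x y := by simp
  map_mul' x y := by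
    have hx : ε x.1 = 0 := x.2
    have hy : ε y.1 = 0 := y.2
    simp [hF, hx, hy]

end Aug

/-! ### The tensor algebra (without unit) of a vector space -/

section Tensor

variable (V : Type u) [AddCommGroup V] [Module ℂ V]

/-- The tensor algebra `T(V) = ⨁_{n ≥ 1} V^{⊗ n}`, the free (non-unital) algebra over the vector
space `V`, realized as the augmentation ideal of the unital tensor algebra. -/
def TAlg : Type u := augKer (TensorAlgebra.algebraMapInv : TensorAlgebra ℂ V →ₐ[ℂ] ℂ)

namespace TAlg

instance : NonUnitalRing (TAlg V) :=
  inferInstanceAs (NonUnitalRing (augKer (TensorAlgebra.algebraMapInv : TensorAlgebra ℂ V →ₐ[ℂ] ℂ)))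
instance : Module ℂ (TAlg V) :=
  inferInstanceAs (Module ℂ (augKer (TensorAlgebra.algebraMapInv : TensorAlgebra ℂ V →ₐ[ℂ] ℂ)))
instance : IsScalarTower ℂ (TAlg V) (TAlg V) :=
  inferInstanceAs (IsScalarTower ℂ
    (augKer (TensorAlgebra.algebraMapInv : TensorAlgebra ℂ V →ₐ[ℂ] ℂ))
    (augKer (TensorAlgebra.algebraMapInv : TensorAlgebra ℂ V →ₐ[ℂ] ℂ)))
instance : SMulCommClass ℂ (TAlg V) (TAlg V) :=
  inferInstanceAs (SMulCommClass ℂ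
    (augKer (TensorAlgebra.algebraMapInv : TensorAlgebra ℂ V →ₐ[ℂ] ℂ))
    (augKer (TensorAlgebra.algebraMapInv : TensorAlgebra ℂ V →ₐ[ℂ] ℂ)))

variable {V}

theorem algebraMapInv_ι (v : V) :
    (TensorAlgebra.algebraMapInv : TensorAlgebra ℂ V →ₐ[ℂ] ℂ) (TensorAlgebra.ι ℂ v) = 0 := by
  simp [TensorAlgebra.algebraMapInv]

/-- The natural embedding `i_V : V → T(V)`. -/
def ι : V →ₗ[ℂ] TAlg V where
  toFun v := ⟨TensorAlgebra.ι ℂ v, algebraMapInv_ι v⟩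
  map_add' x y := Subtype.ext (map_add _ x y)
  map_smul' c x := Subtype.ext (map_smul _ c x)

variable {A : Type w} [NonUnitalRing A] [Module ℂ A] [IsScalarTower ℂ A A] [SMulCommClass ℂ A A]

/-- The algebra homomorphism `T(k) : T(V) → A` extending the linear map `k : V → A`. -/
def lift (k : V →ₗ[ℂ] A) : TAlg V →ₙₐ[ℂ] A :=
  augLift _ (TensorAlgebra.lift ℂ ((Unitization.inrHom ℂ ℂ A) ∘ₗ k)) (fun x => by
    have h : (Unitization.fstHom ℂ A).comp
        (TensorAlgebra.lift ℂ ((Unitization.inrHom ℂ ℂ A) ∘ₗ k)) = TensorAlgebra.algebraMapInv := by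
      ext v
      simp [algebraMapInv_ι]
    exact DFunLike.congr_fun h x)

@[simp] theorem lift_ι (k : V →ₗ[ℂ] A) (v : V) : lift k (ι v) = k v := by
  change (TensorAlgebra.lift ℂ ((Unitization.inrHom ℂ ℂ A) ∘ₗ k) (TensorAlgebra.ι ℂ v) :
    Unitization ℂ A).snd = k v
  simp

end TAlg

end Tensor

/-! ### The involution of the tensor algebra over a `*`-vector space -/

section TensorStar

/-- The opposite of a complex algebra, with complex conjugate scalar multiplication. -/
def ConjOp (U : Type u) : Type u := Uᵐᵒᵖ

variable (U : Type u) [Ring U] [Algebra ℂ U]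

instance : Ring (ConjOp U) := inferInstanceAs (Ring Uᵐᵒᵖ)

instance : Algebra ℂ (ConjOp U) :=
  RingHom.toAlgebra' (S := ConjOp U)
    ((algebraMap ℂ Uᵐᵒᵖ).comp (starRingEnd ℂ))
    (fun c x => Algebra.commutes (A := Uᵐᵒᵖ) (star c) x)

variable {V : Type u} [AddCommGroup V] [Module ℂ V] [StarAddMonoid V] [StarModule ℂ V]

variable {U} in
/-- The identity map `U → ConjOp U`. -/
def ConjOp.mk (x : U) : ConjOp U := (MulOpposite.op x : Uᵐᵒᵖ)

theorem ConjOp.smul_mk (c : ℂ) (x : U) : c • ConjOp.mk x = ConjOp.mk (star c • x) := by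
  rw [Algebra.smul_def]
  change (algebraMap ℂ Uᵐᵒᵖ (star c) * MulOpposite.op x : Uᵐᵒᵖ) = MulOpposite.op (star c • x)
  rw [← Algebra.smul_def]
  rfl

/-- `v ↦ v*`, as a linear map into the conjugate opposite of the tensor algebra. -/
def tensorConj₀ : V →ₗ[ℂ] ConjOp (TensorAlgebra ℂ V) where
  toFun v := ConjOp.mk (TensorAlgebra.ι ℂ (star v))
  map_add' x y := by
    rw [star_add, map_add]
    rfl
  map_smul' c x := by
    rw [RingHom.id_apply, ConjOp.smul_mk, star_smul, map_smul]

/-- The antilinear antihomomorphism of the unital tensor algebra extending `v ↦ v*`. -/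
def tensorConj : TensorAlgebra ℂ V →+* (TensorAlgebra ℂ V)ᵐᵒᵖ :=
  (TensorAlgebra.lift ℂ (tensorConj₀ (V := V))).toRingHom

theorem tensorConj_ι (v : V) :
    tensorConj (TensorAlgebra.ι ℂ v) = MulOpposite.op (TensorAlgebra.ι ℂ (star v)) :=
  TensorAlgebra.lift_ι_apply (tensorConj₀ (V := V)) v

theorem tensorConj_algebraMap (c : ℂ) :
    tensorConj (V := V) (algebraMap ℂ _ c) = MulOpposite.op (algebraMap ℂ _ (star c)) :=
  (TensorAlgebra.lift ℂ (tensorConj₀ (V := V))).commutes c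

/-- The involution `(v₁ ⊗ ⋯ ⊗ vₙ)* = vₙ* ⊗ ⋯ ⊗ v₁*` on the unital tensor algebra. -/
def tensorStar (x : TensorAlgebra ℂ V) : TensorAlgebra ℂ V := (tensorConj x).unop

theorem tensorStar_ι (v : V) :
    tensorStar (TensorAlgebra.ι ℂ v) = TensorAlgebra.ι ℂ (star v) := by
  simp [tensorStar, tensorConj_ι]

theorem tensorStar_algebraMap (c : ℂ) :
    tensorStar (V := V) (algebraMap ℂ _ c) = algebraMap ℂ _ (star c) := by
  simp [tensorStar, tensorConj_algebraMap]

theorem tensorStar_add (x y : TensorAlgebra ℂ V) :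
    tensorStar (x + y) = tensorStar x + tensorStar y := by simp [tensorStar]

theorem tensorStar_mul (x y : TensorAlgebra ℂ V) :
    tensorStar (x * y) = tensorStar y * tensorStar x := by simp [tensorStar]

theorem tensorStar_tensorStar (x : TensorAlgebra ℂ V) : tensorStar (tensorStar x) = x := by
  induction x using TensorAlgebra.induction with
  | algebraMap r => simp [tensorStar_algebraMap]
  | ι v => simp [tensorStar_ι]
  | mul a b ha hb => simp [tensorStar_mul, ha, hb]
  | add a b ha hb => simp [tensorStar_add, ha, hb]

theorem algebraMapInv_tensorStar (x : TensorAlgebra ℂ V) :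
    TensorAlgebra.algebraMapInv (tensorStar x) = star (TensorAlgebra.algebraMapInv x : ℂ) := by
  induction x using TensorAlgebra.induction with
  | algebraMap r => simp [tensorStar_algebraMap]
  | ι v => simp [tensorStar_ι, TAlg.algebraMapInv_ι]
  | mul a b ha hb => simp [tensorStar_mul, ha, hb, mul_comm]
  | add a b ha hb => simp [tensorStar_add, ha, hb]

instance : StarRing (TAlg V) where
  star x := ⟨tensorStar x.1, by
    have hx : TensorAlgebra.algebraMapInv x.1 = (0 : ℂ) := x.2
    change TensorAlgebra.algebraMapInv (tensorStar x.1) = (0 : ℂ)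
    rw [algebraMapInv_tensorStar, hx, star_zero]⟩
  star_involutive x := Subtype.ext (tensorStar_tensorStar x.1)
  star_mul x y := Subtype.ext (tensorStar_mul x.1 y.1)
  star_add x y := Subtype.ext (tensorStar_add x.1 y.1)

instance : StarModule ℂ (TAlg V) where
  star_smul c x := Subtype.ext (by
    change tensorStar (c • x.1) = star c • tensorStar x.1
    rw [Algebra.smul_def, tensorStar_mul, tensorStar_algebraMap, Algebra.smul_def,
      Algebra.commutes])

theorem TAlg.star_ι (v : V) : star (TAlg.ι v) = TAlg.ι (star v) := Subtype.ext (tensorStar_ι v)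

end TensorStar

/-! ### The free product of algebras -/

section FreeProduct

variable (A₁ A₂ : Type u)
  [NonUnitalRing A₁] [Module ℂ A₁] [IsScalarTower ℂ A₁ A₁] [SMulCommClass ℂ A₁ A₁]
  [NonUnitalRing A₂] [Module ℂ A₂] [IsScalarTower ℂ A₂ A₂] [SMulCommClass ℂ A₂ A₂]

/-- The relations identifying the product of two letters from the same algebra with the letter
which is their product in this algebra. -/
inductive FreeProd.Rel : TensorAlgebra ℂ (A₁ × A₂) → TensorAlgebra ℂ (A₁ × A₂) → Prop
  | left (a a' : A₁) : FreeProd.Rel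
      (TensorAlgebra.ι ℂ ((a, 0) : A₁ × A₂) * TensorAlgebra.ι ℂ ((a', 0) : A₁ × A₂))
      (TensorAlgebra.ι ℂ ((a * a', 0) : A₁ × A₂))
  | right (b b' : A₂) : FreeProd.Rel
      (TensorAlgebra.ι ℂ ((0, b) : A₁ × A₂) * TensorAlgebra.ι ℂ ((0, b') : A₁ × A₂))
      (TensorAlgebra.ι ℂ ((0, b * b') : A₁ × A₂))

/-- The free product of `A₁` and `A₂` with a unit adjoined. -/
abbrev UFreeProd : Type u := RingQuot (FreeProd.Rel A₁ A₂)

variable {A₁ A₂}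

/-- Universal property of the free product with a unit adjoined. -/
def UFreeProd.lift {U : Type w} [Ring U] [Algebra ℂ U] (f : A₁ →ₙₐ[ℂ] U) (g : A₂ →ₙₐ[ℂ] U) :
    UFreeProd A₁ A₂ →ₐ[ℂ] U :=
  RingQuot.liftAlgHom ℂ ⟨TensorAlgebra.lift ℂ
    (LinearMap.coprod (f : A₁ →ₗ[ℂ] U) (g : A₂ →ₗ[ℂ] U)), by
      intro x y h
      cases h <;> simp⟩

variable (A₁ A₂)

/-- The character of the free product with a unit adjoined which vanishes on `A₁` and `A₂`. -/
def UFreeProd.counit : UFreeProd A₁ A₂ →ₐ[ℂ] ℂ := UFreeProd.lift 0 0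

/-- The free product `A₁ ⊔ A₂` of two algebras, that is, the coproduct in the category of
(associative, not necessarily unital) complex algebras. -/
def FreeProd : Type u := augKer (UFreeProd.counit A₁ A₂)

namespace FreeProd

instance : NonUnitalRing (FreeProd A₁ A₂) :=
  inferInstanceAs (NonUnitalRing (augKer (UFreeProd.counit A₁ A₂)))
instance : Module ℂ (FreeProd A₁ A₂) :=
  inferInstanceAs (Module ℂ (augKer (UFreeProd.counit A₁ A₂)))
instance : IsScalarTower ℂ (FreeProd A₁ A₂) (FreeProd A₁ A₂) :=
  inferInstanceAs (IsScalarTower ℂ (augKer (UFreeProd.counit A₁ A₂))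
    (augKer (UFreeProd.counit A₁ A₂)))
instance : SMulCommClass ℂ (FreeProd A₁ A₂) (FreeProd A₁ A₂) :=
  inferInstanceAs (SMulCommClass ℂ (augKer (UFreeProd.counit A₁ A₂))
    (augKer (UFreeProd.counit A₁ A₂)))

variable {A₁ A₂}

/-- The image of a pair `(a, b)`, standing for `i₁(a) + i₂(b)`, in the free product with a unit. -/
def letter : A₁ × A₂ →ₗ[ℂ] UFreeProd A₁ A₂ :=
  (RingQuot.mkAlgHom ℂ (FreeProd.Rel A₁ A₂)).toLinearMap ∘ₗ TensorAlgebra.ι ℂ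

theorem _root_.DualSemi.UFreeProd.lift_letter {U : Type w} [Ring U] [Algebra ℂ U]
    (f : A₁ →ₙₐ[ℂ] U) (g : A₂ →ₙₐ[ℂ] U) (p : A₁ × A₂) :
    UFreeProd.lift f g (letter p) = f p.1 + g p.2 := by
  simp [UFreeProd.lift, letter]

theorem counit_letter (p : A₁ × A₂) : UFreeProd.counit A₁ A₂ (letter p) = 0 := by
  simp [UFreeProd.counit, UFreeProd.lift_letter]

theorem letter_mul_left (a a' : A₁) :
    letter ((a, 0) : A₁ × A₂) * letter ((a', 0) : A₁ × A₂) = letter (a * a', 0) := by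
  have h := RingQuot.mkAlgHom_rel ℂ (Rel.left (A₂ := A₂) a a')
  rw [map_mul] at h
  exact h

theorem letter_mul_right (b b' : A₂) :
    letter ((0, b) : A₁ × A₂) * letter ((0, b') : A₁ × A₂) = letter (0, b * b') := by
  have h := RingQuot.mkAlgHom_rel ℂ (Rel.right (A₁ := A₁) b b')
  rw [map_mul] at h
  exact h

variable (A₁ A₂) in
/-- The natural embedding `i₁ : A₁ → A₁ ⊔ A₂`. -/
def inl : A₁ →ₙₐ[ℂ] FreeProd A₁ A₂ where
  toFun a := ⟨letter (a, 0), counit_letter _⟩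
  map_smul' c a := Subtype.ext (by
    change letter (c • a, (0 : A₂)) = c • letter (a, (0 : A₂))
    rw [← map_smul, Prod.smul_mk, smul_zero])
  map_zero' := Subtype.ext (map_zero letter)
  map_add' a a' := Subtype.ext (by
    change letter (a + a', (0 : A₂)) = letter (a, (0 : A₂)) + letter (a', (0 : A₂))
    rw [← map_add, Prod.mk_add_mk, add_zero])
  map_mul' a a' := Subtype.ext (letter_mul_left a a').symm

variable (A₁ A₂) in
/-- The natural embedding `i₂ : A₂ → A₁ ⊔ A₂`. -/
def inr : A₂ →ₙₐ[ℂ] FreeProd A₁ A₂ where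
  toFun b := ⟨letter (0, b), counit_letter _⟩
  map_smul' c b := Subtype.ext (by
    change letter ((0 : A₁), c • b) = c • letter ((0 : A₁), b)
    rw [← map_smul, Prod.smul_mk, smul_zero])
  map_zero' := Subtype.ext (map_zero letter)
  map_add' b b' := Subtype.ext (by
    change letter ((0 : A₁), b + b') = letter ((0 : A₁), b) + letter ((0 : A₁), b')
    rw [← map_add, Prod.mk_add_mk, add_zero])
  map_mul' b b' := Subtype.ext (letter_mul_right b b').symm

variable {C : Type w} [NonUnitalRing C] [Module ℂ C] [IsScalarTower ℂ C C] [SMulCommClass ℂ C C]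

/-- The homomorphism `j₁ ⊔ j₂ : A₁ ⊔ A₂ → C` given by the universal property. -/
def lift (j₁ : A₁ →ₙₐ[ℂ] C) (j₂ : A₂ →ₙₐ[ℂ] C) : FreeProd A₁ A₂ →ₙₐ[ℂ] C :=
  augLift _
    (UFreeProd.lift ((Unitization.inrNonUnitalAlgHom ℂ C).comp j₁)
      ((Unitization.inrNonUnitalAlgHom ℂ C).comp j₂)) (fun x => by
    have h : (Unitization.fstHom ℂ C).comp
        (UFreeProd.lift ((Unitization.inrNonUnitalAlgHom ℂ C).comp j₁)
          ((Unitization.inrNonUnitalAlgHom ℂ C).comp j₂)) = UFreeProd.counit A₁ A₂ := by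
      apply RingQuot.ringQuot_ext'
      apply TensorAlgebra.hom_ext
      apply LinearMap.ext
      intro p
      change (UFreeProd.lift _ _ (letter p) : Unitization ℂ C).fst = UFreeProd.counit A₁ A₂ (letter p)
      rw [counit_letter, UFreeProd.lift_letter]
      simp
    exact DFunLike.congr_fun h x)

@[simp] theorem lift_inl (j₁ : A₁ →ₙₐ[ℂ] C) (j₂ : A₂ →ₙₐ[ℂ] C) (a : A₁) :
    lift j₁ j₂ (inl A₁ A₂ a) = j₁ a := by
  change (UFreeProd.lift _ _ (letter (a, 0)) : Unitization ℂ C).snd = _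
  rw [UFreeProd.lift_letter]
  simp

@[simp] theorem lift_inr (j₁ : A₁ →ₙₐ[ℂ] C) (j₂ : A₂ →ₙₐ[ℂ] C) (b : A₂) :
    lift j₁ j₂ (inr A₁ A₂ b) = j₂ b := by
  change (UFreeProd.lift _ _ (letter (0, b)) : Unitization ℂ C).snd = _
  rw [UFreeProd.lift_letter]
  simp

/-- Every element of the free product with a unit is a scalar plus an element of the subalgebra
generated by the letters. -/
theorem exists_scalar_add (x : UFreeProd A₁ A₂) :
    ∃ (c : ℂ) (y : FreeProd A₁ A₂),
      y ∈ NonUnitalAlgebra.adjoin ℂ (Set.range (inl A₁ A₂) ∪ Set.range (inr A₁ A₂)) ∧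
        x = algebraMap ℂ _ c + y.1 := by
  obtain ⟨t, rfl⟩ := RingQuot.mkAlgHom_surjective ℂ (FreeProd.Rel A₁ A₂) x
  induction t using TensorAlgebra.induction with
  | algebraMap r => exact ⟨r, 0, zero_mem _, by
      rw [AlgHom.commutes]
      exact (add_zero _).symm⟩
  | ι p =>
    refine ⟨0, inl A₁ A₂ p.1 + inr A₁ A₂ p.2,
      add_mem (NonUnitalAlgebra.subset_adjoin ℂ (Or.inl ⟨_, rfl⟩))
        (NonUnitalAlgebra.subset_adjoin ℂ (Or.inr ⟨_, rfl⟩)), ?_⟩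
    rw [map_zero, zero_add]
    change letter p = letter (p.1, 0) + letter (0, p.2)
    rw [← map_add]
    simp
  | mul a b ha hb =>
    obtain ⟨c, y, hy, h⟩ := ha
    obtain ⟨d, z, hz, h'⟩ := hb
    refine ⟨c * d, c • z + d • y + y * z,
      add_mem (add_mem (SMulMemClass.smul_mem c hz) (SMulMemClass.smul_mem d hy))
        (mul_mem hy hz), ?_⟩
    rw [map_mul, h, h']
    change _ = algebraMap ℂ _ (c * d) + (c • z.1 + d • y.1 + y.1 * z.1)
    rw [add_mul, mul_add, mul_add, ← Algebra.commutes d y.1, map_mul, Algebra.smul_def,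
      Algebra.smul_def]
    abel
  | add a b ha hb =>
    obtain ⟨c, y, hy, h⟩ := ha
    obtain ⟨d, z, hz, h'⟩ := hb
    refine ⟨c + d, y + z, add_mem hy hz, ?_⟩
    rw [map_add, h, h']
    change _ = algebraMap ℂ _ (c + d) + (y.1 + z.1)
    rw [map_add]
    abel

/-- `A₁ ⊔ A₂` is generated by the images of `A₁` and `A₂`. -/
theorem adjoin_eq_top :
    NonUnitalAlgebra.adjoin ℂ (Set.range (inl A₁ A₂) ∪ Set.range (inr A₁ A₂)) = ⊤ := by
  rw [eq_top_iff]
  intro x _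
  obtain ⟨c, y, hy, h⟩ := exists_scalar_add x.1
  have hx : UFreeProd.counit A₁ A₂ x.1 = 0 := x.2
  have hy' : UFreeProd.counit A₁ A₂ y.1 = 0 := y.2
  rw [h, map_add, hy', AlgHom.commutes, add_zero] at hx
  have hc : c = 0 := hx
  rw [hc, map_zero, zero_add] at h
  rwa [show x = y from Subtype.ext h]

/-- Uniqueness in the universal property of the free product. -/
theorem hom_ext {f g : FreeProd A₁ A₂ →ₙₐ[ℂ] C}
    (h₁ : ∀ a, f (inl A₁ A₂ a) = g (inl A₁ A₂ a)) (h₂ : ∀ b, f (inr A₁ A₂ b) = g (inr A₁ A₂ b)) :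
    f = g := by
  refine NonUnitalAlgHom.ext fun x => ?_
  have hx : x ∈ NonUnitalAlgebra.adjoin ℂ (Set.range (inl A₁ A₂) ∪ Set.range (inr A₁ A₂)) := by
    rw [adjoin_eq_top]; trivial
  induction hx using NonUnitalAlgebra.adjoin_induction with
  | mem x hx =>
    rcases hx with ⟨a, rfl⟩ | ⟨b, rfl⟩
    · exact h₁ a
    · exact h₂ b
  | add x y _ _ hx hy => rw [map_add, map_add, hx, hy]
  | zero => rw [map_zero, map_zero]
  | mul x y _ _ hx hy => rw [map_mul, map_mul, hx, hy]
  | smul r x _ hx => rw [map_smul, map_smul, hx]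

end FreeProd

end FreeProduct

section FreeProductMaps

variable {A₁ A₂ A₃ C₁ C₂ : Type u}
  [NonUnitalRing A₁] [Module ℂ A₁] [IsScalarTower ℂ A₁ A₁] [SMulCommClass ℂ A₁ A₁]
  [NonUnitalRing A₂] [Module ℂ A₂] [IsScalarTower ℂ A₂ A₂] [SMulCommClass ℂ A₂ A₂]
  [NonUnitalRing A₃] [Module ℂ A₃] [IsScalarTower ℂ A₃ A₃] [SMulCommClass ℂ A₃ A₃]
  [NonUnitalRing C₁] [Module ℂ C₁] [IsScalarTower ℂ C₁ C₁] [SMulCommClass ℂ C₁ C₁]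
  [NonUnitalRing C₂] [Module ℂ C₂] [IsScalarTower ℂ C₂ C₂] [SMulCommClass ℂ C₂ C₂]

/-- The homomorphism `j₁ ∐ j₂ : A₁ ⊔ A₂ → C₁ ⊔ C₂`. -/
def FreeProd.map (j₁ : A₁ →ₙₐ[ℂ] C₁) (j₂ : A₂ →ₙₐ[ℂ] C₂) :
    FreeProd A₁ A₂ →ₙₐ[ℂ] FreeProd C₁ C₂ :=
  FreeProd.lift ((FreeProd.inl C₁ C₂).comp j₁) ((FreeProd.inr C₁ C₂).comp j₂)

variable (A₁ A₂ A₃) in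
/-- The natural identification `(A₁ ⊔ A₂) ⊔ A₃ → A₁ ⊔ (A₂ ⊔ A₃)`. -/
def FreeProd.assoc : FreeProd (FreeProd A₁ A₂) A₃ →ₙₐ[ℂ] FreeProd A₁ (FreeProd A₂ A₃) :=
  FreeProd.lift
    (FreeProd.lift (FreeProd.inl A₁ (FreeProd A₂ A₃))
      ((FreeProd.inr A₁ (FreeProd A₂ A₃)).comp (FreeProd.inl A₂ A₃)))
    ((FreeProd.inr A₁ (FreeProd A₂ A₃)).comp (FreeProd.inr A₂ A₃))

end FreeProductMaps

/-! ### The involution of the free product of `*`-algebras -/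

section FreeProductStar

variable {A₁ A₂ : Type u}
  [NonUnitalRing A₁] [Module ℂ A₁] [IsScalarTower ℂ A₁ A₁] [SMulCommClass ℂ A₁ A₁]
  [NonUnitalRing A₂] [Module ℂ A₂] [IsScalarTower ℂ A₂ A₂] [SMulCommClass ℂ A₂ A₂]
  [StarRing A₁] [StarModule ℂ A₁] [StarRing A₂] [StarModule ℂ A₂]

/-- The involution of the tensor algebra, passed to the free product with a unit adjoined. -/
def UFreeProd.conj : UFreeProd A₁ A₂ →+* (UFreeProd A₁ A₂)ᵐᵒᵖ :=
  RingQuot.lift ⟨((RingQuot.mkRingHom (FreeProd.Rel A₁ A₂)).op).comp tensorConj, by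
    intro x y h
    cases h with
    | left a a' =>
      have h := RingQuot.mkRingHom_rel (FreeProd.Rel.left (A₂ := A₂) (star a') (star a))
      simpa [tensorConj_ι, Prod.star_def] using congrArg MulOpposite.op h
    | right b b' =>
      have h := RingQuot.mkRingHom_rel (FreeProd.Rel.right (A₁ := A₁) (star b') (star b))
      simpa [tensorConj_ι, Prod.star_def] using congrArg MulOpposite.op h⟩

/-- The involution of the free product with a unit adjoined. -/
def UFreeProd.starFun (x : UFreeProd A₁ A₂) : UFreeProd A₁ A₂ := (UFreeProd.conj x).unop

theorem UFreeProd.starFun_mk (t : TensorAlgebra ℂ (A₁ × A₂)) :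
    UFreeProd.starFun (RingQuot.mkRingHom (FreeProd.Rel A₁ A₂) t)
      = RingQuot.mkRingHom (FreeProd.Rel A₁ A₂) (tensorStar t) := by
  simp [UFreeProd.starFun, UFreeProd.conj, tensorStar]

theorem UFreeProd.counit_mk (t : TensorAlgebra ℂ (A₁ × A₂)) :
    UFreeProd.counit A₁ A₂ (RingQuot.mkRingHom (FreeProd.Rel A₁ A₂) t)
      = TensorAlgebra.algebraMapInv t := by
  have h : (UFreeProd.counit A₁ A₂).comp (RingQuot.mkAlgHom ℂ (FreeProd.Rel A₁ A₂))
      = TensorAlgebra.algebraMapInv := by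
    apply TensorAlgebra.hom_ext
    apply LinearMap.ext
    intro p
    change UFreeProd.counit A₁ A₂ (FreeProd.letter p)
      = TensorAlgebra.algebraMapInv (TensorAlgebra.ι ℂ p)
    rw [FreeProd.counit_letter, TAlg.algebraMapInv_ι]
  rw [← h, ← RingQuot.mkAlgHom_coe ℂ]
  rfl

theorem UFreeProd.starFun_starFun (x : UFreeProd A₁ A₂) :
    UFreeProd.starFun (UFreeProd.starFun x) = x := by
  obtain ⟨t, rfl⟩ := RingQuot.mkRingHom_surjective (FreeProd.Rel A₁ A₂) x
  rw [UFreeProd.starFun_mk, UFreeProd.starFun_mk, tensorStar_tensorStar]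

theorem UFreeProd.counit_starFun (x : UFreeProd A₁ A₂) :
    UFreeProd.counit A₁ A₂ (UFreeProd.starFun x) = star (UFreeProd.counit A₁ A₂ x) := by
  obtain ⟨t, rfl⟩ := RingQuot.mkRingHom_surjective (FreeProd.Rel A₁ A₂) x
  rw [UFreeProd.starFun_mk, UFreeProd.counit_mk, UFreeProd.counit_mk, algebraMapInv_tensorStar]

instance : StarRing (FreeProd A₁ A₂) where
  star x := ⟨UFreeProd.starFun x.1, by
    have hx : UFreeProd.counit A₁ A₂ x.1 = 0 := x.2
    change UFreeProd.counit A₁ A₂ (UFreeProd.starFun x.1) = 0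
    rw [UFreeProd.counit_starFun, hx, star_zero]⟩
  star_involutive x := Subtype.ext (UFreeProd.starFun_starFun x.1)
  star_mul x y := Subtype.ext (by
    change UFreeProd.starFun (x.1 * y.1) = UFreeProd.starFun y.1 * UFreeProd.starFun x.1
    simp [UFreeProd.starFun])
  star_add x y := Subtype.ext (by
    change UFreeProd.starFun (x.1 + y.1) = UFreeProd.starFun x.1 + UFreeProd.starFun y.1
    simp [UFreeProd.starFun])

instance : StarModule ℂ (FreeProd A₁ A₂) where
  star_smul c x := Subtype.ext (by
    change UFreeProd.starFun (c • x.1) = star c • UFreeProd.starFun x.1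
    obtain ⟨t, ht⟩ := RingQuot.mkAlgHom_surjective ℂ (FreeProd.Rel A₁ A₂) x.1
    have e : ∀ s, RingQuot.mkAlgHom ℂ (FreeProd.Rel A₁ A₂) s
        = RingQuot.mkRingHom (FreeProd.Rel A₁ A₂) s := fun s => by
      rw [← RingQuot.mkAlgHom_coe ℂ]; rfl
    rw [← ht, ← map_smul, e, e, UFreeProd.starFun_mk, UFreeProd.starFun_mk, ← e, ← e, ← map_smul,
      Algebra.smul_def, tensorStar_mul, tensorStar_algebraMap, Algebra.smul_def,
      Algebra.commutes])

theorem FreeProd.star_inl (a : A₁) :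
    star (FreeProd.inl A₁ A₂ a) = FreeProd.inl A₁ A₂ (star a) := Subtype.ext (by
  change UFreeProd.starFun (FreeProd.letter (a, 0)) = FreeProd.letter (star a, 0)
  have h := UFreeProd.starFun_mk (TensorAlgebra.ι ℂ ((a, 0) : A₁ × A₂))
  rw [tensorStar_ι, Prod.star_def, star_zero, ← RingQuot.mkAlgHom_coe ℂ] at h
  exact h)

theorem FreeProd.star_inr (b : A₂) :
    star (FreeProd.inr A₁ A₂ b) = FreeProd.inr A₁ A₂ (star b) := Subtype.ext (by
  change UFreeProd.starFun (FreeProd.letter (0, b)) = FreeProd.letter (0, star b)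
  have h := UFreeProd.starFun_mk (TensorAlgebra.ι ℂ ((0, b) : A₁ × A₂))
  rw [tensorStar_ι, Prod.star_def, star_zero, ← RingQuot.mkAlgHom_coe ℂ] at h
  exact h)

end FreeProductStar

/-! ### Linear maps on a free product acting letter by letter -/

section WordMap

variable {A₁ A₂ C : Type u}
  [NonUnitalRing A₁] [Module ℂ A₁] [IsScalarTower ℂ A₁ A₁] [SMulCommClass ℂ A₁ A₁]
  [NonUnitalRing A₂] [Module ℂ A₂] [IsScalarTower ℂ A₂ A₂] [SMulCommClass ℂ A₂ A₂]
  [NonUnitalRing C] [Module ℂ C] [IsScalarTower ℂ C C] [SMulCommClass ℂ C C]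

/-- Values in `C` (with a unit adjoined) together with at most one unevaluated left-most letter. -/
abbrev Pending (A₁ A₂ C : Type u) [NonUnitalRing A₁] [Module ℂ A₁] [NonUnitalRing A₂] [Module ℂ A₂]
    [NonUnitalRing C] [Module ℂ C] : Type u :=
  Unitization ℂ C × ((A₁ ⊗[ℂ] Unitization ℂ C) × (A₂ ⊗[ℂ] Unitization ℂ C))

/-- `a ⊗ c ↦ f(a) c`. -/
def evalLetter {A : Type u} [NonUnitalRing A] [Module ℂ A] (f : A →ₗ[ℂ] C) :
    A ⊗[ℂ] Unitization ℂ C →ₗ[ℂ] Unitization ℂ C :=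
  LinearMap.mul' ℂ (Unitization ℂ C) ∘ₗ
    TensorProduct.map ((Unitization.inrHom ℂ ℂ C) ∘ₗ f) LinearMap.id

/-- Evaluation of the pending letter. -/
def evalPending (f : A₁ →ₗ[ℂ] C) (g : A₂ →ₗ[ℂ] C) :
    Pending A₁ A₂ C →ₗ[ℂ] Unitization ℂ C :=
  LinearMap.coprod LinearMap.id (LinearMap.coprod (evalLetter f) (evalLetter g))

/-- Left multiplication of `A` on `A ⊗ W`. -/
def letterMul {A : Type u} [NonUnitalRing A] [Module ℂ A] [IsScalarTower ℂ A A]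
    [SMulCommClass ℂ A A] (W : Type u) [AddCommGroup W] [Module ℂ W] :
    A →ₙₐ[ℂ] Module.End ℂ (A ⊗[ℂ] W) where
  toFun a := (LinearMap.mulLeft ℂ a).rTensor W
  map_smul' c a := TensorProduct.ext' fun x w => by
    simp [TensorProduct.smul_tmul', smul_mul_assoc]
  map_zero' := TensorProduct.ext' fun x w => by simp
  map_add' a a' := TensorProduct.ext' fun x w => by simp [TensorProduct.add_tmul, add_mul]
  map_mul' a a' := TensorProduct.ext' fun x w => by simp

/-- Left multiplication by a letter from `A₁`: it is merged with a pending letter from `A₁`, while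
a pending letter from `A₂` is evaluated first. -/
def pushLeft (g : A₂ →ₗ[ℂ] C) : A₁ →ₙₐ[ℂ] Module.End ℂ (Pending A₁ A₂ C) where
  toFun a :=
    { toFun := fun n => (0, a ⊗ₜ (n.1 + evalLetter g n.2.2) + letterMul _ a n.2.1, 0)
      map_add' := fun m n => by
        simp only [Prod.fst_add, Prod.snd_add, map_add, TensorProduct.tmul_add, Prod.mk_add_mk,
          add_zero]
        congr 2
        abel
      map_smul' := fun c n => by
        simp [TensorProduct.tmul_add] }
  map_smul' c a := LinearMap.ext fun n => by
    simp [TensorProduct.smul_tmul']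
  map_zero' := LinearMap.ext fun n => by simp
  map_add' a a' := LinearMap.ext fun n => by
    simp only [map_add, TensorProduct.add_tmul, LinearMap.coe_mk, AddHom.coe_mk,
      LinearMap.add_apply, Prod.mk_add_mk, add_zero]
    congr 2
    abel
  map_mul' a a' := LinearMap.ext fun n => by
    simp only [map_mul, LinearMap.coe_mk, AddHom.coe_mk, Module.End.mul_apply, map_add, map_zero,
      add_zero, TensorProduct.tmul_zero, zero_add]
    congr 3

/-- Left multiplication by a letter from `A₂`: it is merged with a pending letter from `A₂`, while
a pending letter from `A₁` is evaluated first. -/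
def pushRight (f : A₁ →ₗ[ℂ] C) : A₂ →ₙₐ[ℂ] Module.End ℂ (Pending A₁ A₂ C) where
  toFun b :=
    { toFun := fun n => (0, 0, b ⊗ₜ (n.1 + evalLetter f n.2.1) + letterMul _ b n.2.2)
      map_add' := fun m n => by
        simp only [Prod.fst_add, Prod.snd_add, map_add, TensorProduct.tmul_add, Prod.mk_add_mk,
          add_zero]
        congr 2
        abel
      map_smul' := fun c n => by
        simp [TensorProduct.tmul_add] }
  map_smul' c b := LinearMap.ext fun n => by
    simp [TensorProduct.smul_tmul']
  map_zero' := LinearMap.ext fun n => by simp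
  map_add' b b' := LinearMap.ext fun n => by
    simp only [map_add, TensorProduct.add_tmul, LinearMap.coe_mk, AddHom.coe_mk,
      LinearMap.add_apply, Prod.mk_add_mk, add_zero]
    congr 2
    abel
  map_mul' b b' := LinearMap.ext fun n => by
    simp only [map_mul, LinearMap.coe_mk, AddHom.coe_mk, Module.End.mul_apply, map_add, map_zero,
      add_zero, TensorProduct.tmul_zero, zero_add]
    congr 3

theorem pushLeft_apply (g : A₂ →ₗ[ℂ] C) (a : A₁) (n : Pending A₁ A₂ C) :
    pushLeft g a n = (0, a ⊗ₜ (n.1 + evalLetter g n.2.2) + letterMul _ a n.2.1, 0) := rfl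

theorem pushRight_apply (f : A₁ →ₗ[ℂ] C) (b : A₂) (n : Pending A₁ A₂ C) :
    pushRight f b n = (0, 0, b ⊗ₜ (n.1 + evalLetter f n.2.1) + letterMul _ b n.2.2) := rfl

theorem evalLetter_tmul {A : Type u} [NonUnitalRing A] [Module ℂ A] (f : A →ₗ[ℂ] C) (a : A)
    (c : Unitization ℂ C) : evalLetter f (a ⊗ₜ c) = Unitization.inr (f a) * c := by
  simp [evalLetter]

/-- For linear maps `f : A₁ → C` and `g : A₂ → C` into an algebra `C`, the linear map
`A₁ ⊔ A₂ → C` sending each alternating word `x₁ ⊗ ⋯ ⊗ xₙ` to the product in `C` of the images of its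
letters under `f`, respectively `g` (see `wordMap_word`). It is the linear map given by the
decomposition of `A₁ ⊔ A₂` as the direct sum of the alternating tensor products of `A₁` and `A₂`. -/
def wordMap (f : A₁ →ₗ[ℂ] C) (g : A₂ →ₗ[ℂ] C) : FreeProd A₁ A₂ →ₗ[ℂ] C where
  toFun x := (evalPending f g
    (FreeProd.lift (pushLeft (C := C) g) (pushRight (C := C) f) x (1, 0))).snd
  map_add' x y := by simp
  map_smul' c x := by simp

/-- The product `h(x) h(x₂) ⋯ h(xₙ)` for a non-empty word with first letter `x`. -/
def wordProd {X D : Type u} [Mul D] (h : X → D) : X → List X → D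
  | x, [] => h x
  | x, y :: l => h x * wordProd h y l

theorem evalPending_push (f : A₁ →ₗ[ℂ] C) (g : A₂ →ₗ[ℂ] C) (x : A₁ ⊕ A₂) (l : List (A₁ ⊕ A₂))
    (hl : (x :: l).IsChain (fun y z => y.isLeft ≠ z.isLeft)) :
    ∃ c : Unitization ℂ C,
      (FreeProd.lift (pushLeft (C := C) g) (pushRight (C := C) f)
        (wordProd (Sum.elim (FreeProd.inl A₁ A₂) (FreeProd.inr A₁ A₂)) x l) (1, 0)
          = Sum.elim (fun a => (0, a ⊗ₜ c, 0)) (fun b => (0, 0, b ⊗ₜ c)) x) ∧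
      (Unitization.inr (Sum.elim f g x) * c = Unitization.inr (wordProd (Sum.elim f g) x l)) := by
  induction l generalizing x with
  | nil =>
    refine ⟨1, ?_, by simp [wordProd]⟩
    cases x <;> simp [wordProd, pushLeft_apply, pushRight_apply]
  | cons y l ih =>
    obtain ⟨hxy, hl'⟩ := List.isChain_cons_cons.1 hl
    obtain ⟨c, h₁, h₂⟩ := ih y hl'
    refine ⟨Unitization.inr (wordProd (Sum.elim f g) y l), ?_, by simp [wordProd]⟩
    rw [wordProd, map_mul, Module.End.mul_apply, h₁, ← h₂]
    cases x <;> cases y <;>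
      simp [pushLeft_apply, pushRight_apply, evalLetter_tmul] at hxy ⊢

/-- On alternating words, `wordMap` is the product of the images of the letters. -/
theorem wordMap_word (f : A₁ →ₗ[ℂ] C) (g : A₂ →ₗ[ℂ] C) (x : A₁ ⊕ A₂) (l : List (A₁ ⊕ A₂))
    (hl : (x :: l).IsChain (fun y z => y.isLeft ≠ z.isLeft)) :
    wordMap f g (wordProd (Sum.elim (FreeProd.inl A₁ A₂) (FreeProd.inr A₁ A₂)) x l)
      = wordProd (Sum.elim f g) x l := by
  obtain ⟨c, h₁, h₂⟩ := evalPending_push f g x l hl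
  change (evalPending f g _).snd = _
  rw [h₁, ← Unitization.snd_inr ℂ (wordProd (Sum.elim f g) x l), ← h₂]
  cases x <;> simp [evalPending, evalLetter_tmul]

end WordMap

/-! ### Independences -/

/-- A product of linear functionals on algebras with values in the linear functionals on the free
products, such that the axioms of a (not necessarily positive) `⊙`-independence hold. -/
structure Independence : Type (u + 1) where
  /-- The functional `φ₁ ⊙ φ₂` on `A₁ ⊔ A₂`. -/
  prod : ∀ {A₁ A₂ : Type u}
    [NonUnitalRing A₁] [Module ℂ A₁] [IsScalarTower ℂ A₁ A₁] [SMulCommClass ℂ A₁ A₁]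
    [NonUnitalRing A₂] [Module ℂ A₂] [IsScalarTower ℂ A₂ A₂] [SMulCommClass ℂ A₂ A₂],
    (A₁ →ₗ[ℂ] ℂ) → (A₂ →ₗ[ℂ] ℂ) → (FreeProd A₁ A₂ →ₗ[ℂ] ℂ)
  /-- `(φ₁ ⊙ φ₂) ∘ i₁ = φ₁` -/
  prod_inl : ∀ {A₁ A₂ : Type u}
    [NonUnitalRing A₁] [Module ℂ A₁] [IsScalarTower ℂ A₁ A₁] [SMulCommClass ℂ A₁ A₁]
    [NonUnitalRing A₂] [Module ℂ A₂] [IsScalarTower ℂ A₂ A₂] [SMulCommClass ℂ A₂ A₂]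
    (φ₁ : A₁ →ₗ[ℂ] ℂ) (φ₂ : A₂ →ₗ[ℂ] ℂ) (a : A₁), prod φ₁ φ₂ (FreeProd.inl A₁ A₂ a) = φ₁ a
  /-- `(φ₁ ⊙ φ₂) ∘ i₂ = φ₂` -/
  prod_inr : ∀ {A₁ A₂ : Type u}
    [NonUnitalRing A₁] [Module ℂ A₁] [IsScalarTower ℂ A₁ A₁] [SMulCommClass ℂ A₁ A₁]
    [NonUnitalRing A₂] [Module ℂ A₂] [IsScalarTower ℂ A₂ A₂] [SMulCommClass ℂ A₂ A₂]
    (φ₁ : A₁ →ₗ[ℂ] ℂ) (φ₂ : A₂ →ₗ[ℂ] ℂ) (b : A₂), prod φ₁ φ₂ (FreeProd.inr A₁ A₂ b) = φ₂ b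
  /-- `(φ₁ ⊙ φ₂) ⊙ φ₃ = φ₁ ⊙ (φ₂ ⊙ φ₃)` -/
  prod_assoc : ∀ {A₁ A₂ A₃ : Type u}
    [NonUnitalRing A₁] [Module ℂ A₁] [IsScalarTower ℂ A₁ A₁] [SMulCommClass ℂ A₁ A₁]
    [NonUnitalRing A₂] [Module ℂ A₂] [IsScalarTower ℂ A₂ A₂] [SMulCommClass ℂ A₂ A₂]
    [NonUnitalRing A₃] [Module ℂ A₃] [IsScalarTower ℂ A₃ A₃] [SMulCommClass ℂ A₃ A₃]
    (φ₁ : A₁ →ₗ[ℂ] ℂ) (φ₂ : A₂ →ₗ[ℂ] ℂ) (φ₃ : A₃ →ₗ[ℂ] ℂ) (x : FreeProd (FreeProd A₁ A₂) A₃),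
    prod (prod φ₁ φ₂) φ₃ x = prod φ₁ (prod φ₂ φ₃) (FreeProd.assoc A₁ A₂ A₃ x)
  /-- `(φ₁ ∘ j₁) ⊙ (φ₂ ∘ j₂) = (φ₁ ⊙ φ₂) ∘ (j₁ ∐ j₂)` -/
  prod_comp : ∀ {A₁ A₂ C₁ C₂ : Type u}
    [NonUnitalRing A₁] [Module ℂ A₁] [IsScalarTower ℂ A₁ A₁] [SMulCommClass ℂ A₁ A₁]
    [NonUnitalRing A₂] [Module ℂ A₂] [IsScalarTower ℂ A₂ A₂] [SMulCommClass ℂ A₂ A₂]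
    [NonUnitalRing C₁] [Module ℂ C₁] [IsScalarTower ℂ C₁ C₁] [SMulCommClass ℂ C₁ C₁]
    [NonUnitalRing C₂] [Module ℂ C₂] [IsScalarTower ℂ C₂ C₂] [SMulCommClass ℂ C₂ C₂]
    (φ₁ : C₁ →ₗ[ℂ] ℂ) (φ₂ : C₂ →ₗ[ℂ] ℂ) (j₁ : A₁ →ₙₐ[ℂ] C₁) (j₂ : A₂ →ₙₐ[ℂ] C₂),
    prod (φ₁ ∘ₗ (j₁ : A₁ →ₗ[ℂ] C₁)) (φ₂ ∘ₗ (j₂ : A₂ →ₗ[ℂ] C₂))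
      = prod φ₁ φ₂ ∘ₗ (FreeProd.map j₁ j₂ : FreeProd A₁ A₂ →ₗ[ℂ] FreeProd C₁ C₂)

/-! ### Dual semigroups -/

section DualSemigroups

variable {B : Type u} [NonUnitalRing B] [Module ℂ B] [IsScalarTower ℂ B B] [SMulCommClass ℂ B B]

/-- A `*`-algebra `B` with the homomorphism `Δ : B → B ⊔ B` is a dual semigroup. -/
structure IsDualSemigroup [StarRing B] [StarModule ℂ B] (Δ : B →ₙₐ[ℂ] FreeProd B B) : Prop where
  map_star : ∀ b, Δ (star b) = star (Δ b)
  /-- `(Δ ∐ id) ∘ Δ = (id ∐ Δ) ∘ Δ` -/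
  coassoc : ∀ b, FreeProd.assoc B B B (FreeProd.map Δ (NonUnitalAlgHom.id ℂ B) (Δ b))
    = FreeProd.map (NonUnitalAlgHom.id ℂ B) Δ (Δ b)
  /-- `(0 ⊔ id) ∘ Δ = id` -/
  counit_left : ∀ b, FreeProd.lift (0 : B →ₙₐ[ℂ] B) (NonUnitalAlgHom.id ℂ B) (Δ b) = b
  /-- `(id ⊔ 0) ∘ Δ = id` -/
  counit_right : ∀ b, FreeProd.lift (NonUnitalAlgHom.id ℂ B) (0 : B →ₙₐ[ℂ] B) (Δ b) = b

/-- The comultiplication `T(Δ) : T(B) → T(B) ⊔ T(B)` extending `(i_B ⊔ i_B) ∘ Δ`, where `i_B ⊔ i_B`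
replaces each letter `b` of an alternating word by `i_B(b)`, in the same copy of `T(B)`. -/
def tensorComul (Δ : B →ₙₐ[ℂ] FreeProd B B) : TAlg B →ₙₐ[ℂ] FreeProd (TAlg B) (TAlg B) :=
  TAlg.lift (wordMap
    ((FreeProd.inl (TAlg B) (TAlg B) : TAlg B →ₗ[ℂ] FreeProd (TAlg B) (TAlg B)) ∘ₗ TAlg.ι)
    ((FreeProd.inr (TAlg B) (TAlg B) : TAlg B →ₗ[ℂ] FreeProd (TAlg B) (TAlg B)) ∘ₗ TAlg.ι)
      ∘ₗ (Δ : B →ₗ[ℂ] FreeProd B B))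

variable (B) in
/-- The multiplication map `M = T(id) : T(B) → B`. -/
def mulMap : TAlg B →ₙₐ[ℂ] B := TAlg.lift LinearMap.id

/-- The convolution `φ₁ ⋆ φ₂ = (φ₁ ⊙ φ₂) ∘ Δ`. -/
def conv (P : Independence.{u}) (Δ : B →ₙₐ[ℂ] FreeProd B B) (φ₁ φ₂ : B →ₗ[ℂ] ℂ) : B →ₗ[ℂ] ℂ :=
  P.prod φ₁ φ₂ ∘ₗ (Δ : B →ₗ[ℂ] FreeProd B B)

end DualSemigroups

/-! ### Convolution exponentials on coalgebras -/

section CoalgebraExp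

variable {C : Type u} [AddCommGroup C] [Module ℂ C]

/-- The convolution powers `F^{⋆ n}` of a linear functional with respect to a comultiplication
`Δ` and a counit `δ`. -/
def coalgPow (Δ : C →ₗ[ℂ] C ⊗[ℂ] C) (δ F : C →ₗ[ℂ] ℂ) : ℕ → (C →ₗ[ℂ] ℂ)
  | 0 => δ
  | n + 1 => LinearMap.mul' ℂ ℂ ∘ₗ TensorProduct.map (coalgPow Δ δ F n) F ∘ₗ Δ

/-- `E = exp_⋆ F`, that is, the series `∑ F^{⋆ n} / n!` converges pointwise to `E`. -/
def IsCoalgExp (Δ : C →ₗ[ℂ] C ⊗[ℂ] C) (δ F E : C →ₗ[ℂ] ℂ) : Prop :=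
  ∀ c, HasSum (fun n : ℕ => (n.factorial : ℂ)⁻¹ * coalgPow Δ δ F n c) (E c)

end CoalgebraExp

/-! ### Convolution exponentials on dual semigroups -/

section Exp

variable {V : Type u} [AddCommGroup V] [Module ℂ V]

/-- The character `S(φ) : S(V) → ℂ` extending a linear functional `φ` on `V`. -/
def symChar (φ : V →ₗ[ℂ] ℂ) : SymmetricAlgebra ℂ V →ₐ[ℂ] ℂ := SymmetricAlgebra.lift φ

theorem differentiable_symChar (ψ : V →ₗ[ℂ] ℂ) (c : SymmetricAlgebra ℂ V) :
    Differentiable ℝ (fun t : ℝ => symChar (t • ψ) c) := by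
  induction c using SymmetricAlgebra.induction with
  | algebraMap r => simp
  | ι v =>
    simp only [symChar, SymmetricAlgebra.lift_ι_apply, LinearMap.smul_apply]
    fun_prop
  | mul a b ha hb =>
    simp only [map_mul]
    exact ha.mul hb
  | add a b ha hb =>
    simp only [map_add]
    exact ha.add hb

/-- The linear functional `D(ψ)(c) = d/dt S(t ψ)(c) |_{t = 0}` on `S(V)`. -/
def symDeriv (ψ : V →ₗ[ℂ] ℂ) : SymmetricAlgebra ℂ V →ₗ[ℂ] ℂ where
  toFun c := deriv (fun t : ℝ => symChar (t • ψ) c) 0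
  map_add' x y := by
    simp only [map_add]
    exact deriv_add (differentiable_symChar ψ x 0) (differentiable_symChar ψ y 0)
  map_smul' r x := by
    simp only [map_smul]
    exact deriv_const_smul r (differentiable_symChar ψ x 0)

/-- `σ : A₁ ⊔ A₂ → S(A₁) ⊗ S(A₂)` represents the independence, in the sense that
`φ₁ ⊙ φ₂ = (S(φ₁) ⊗ S(φ₂)) ∘ σ` for all linear functionals `φ₁` and `φ₂`. -/
def IsSigma (P : Independence.{u}) {A₁ A₂ : Type u}
    [NonUnitalRing A₁] [Module ℂ A₁] [IsScalarTower ℂ A₁ A₁] [SMulCommClass ℂ A₁ A₁]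
    [NonUnitalRing A₂] [Module ℂ A₂] [IsScalarTower ℂ A₂ A₂] [SMulCommClass ℂ A₂ A₂]
    (σ : FreeProd A₁ A₂ →ₗ[ℂ] SymmetricAlgebra ℂ A₁ ⊗[ℂ] SymmetricAlgebra ℂ A₂) : Prop :=
  ∀ (φ₁ : A₁ →ₗ[ℂ] ℂ) (φ₂ : A₂ →ₗ[ℂ] ℂ), P.prod φ₁ φ₂ =
    LinearMap.mul' ℂ ℂ ∘ₗ
      TensorProduct.map (symChar φ₁).toLinearMap (symChar φ₂).toLinearMap ∘ₗ σ

variable {B : Type u} [NonUnitalRing B] [Module ℂ B] [IsScalarTower ℂ B B] [SMulCommClass ℂ B B]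

/-- The comultiplication `S(σ ∘ Δ)` of `S(B)`. -/
def symComul (σ : FreeProd B B →ₗ[ℂ] SymmetricAlgebra ℂ B ⊗[ℂ] SymmetricAlgebra ℂ B)
    (Δ : B →ₙₐ[ℂ] FreeProd B B) :
    SymmetricAlgebra ℂ B →ₐ[ℂ] SymmetricAlgebra ℂ B ⊗[ℂ] SymmetricAlgebra ℂ B :=
  SymmetricAlgebra.lift (σ ∘ₗ (Δ : B →ₗ[ℂ] FreeProd B B))

/-- `χ = exp_⋆ ψ` for a linear functional `ψ` on `(B, Δ)`: `χ` is the restriction to `B` of the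
convolution exponential of `D(ψ)` on `S(B)` with comultiplication `S(σ ∘ Δ)` and counit `S(0)`. -/
def IsConvExp (P : Independence.{u}) (Δ : B →ₙₐ[ℂ] FreeProd B B) (ψ χ : B →ₗ[ℂ] ℂ) : Prop :=
  ∃ (σ : FreeProd B B →ₗ[ℂ] SymmetricAlgebra ℂ B ⊗[ℂ] SymmetricAlgebra ℂ B)
    (E : SymmetricAlgebra ℂ B →ₗ[ℂ] ℂ),
    IsSigma P σ ∧
    IsCoalgExp (symComul σ Δ).toLinearMap (symChar (0 : B →ₗ[ℂ] ℂ)).toLinearMap (symDeriv ψ) E ∧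
    χ = E ∘ₗ SymmetricAlgebra.ι ℂ B

open Classical in
/-- The convolution exponential `exp_⋆ ψ`, with the value `0` if there is none. -/
def convExp (P : Independence.{u}) (Δ : B →ₙₐ[ℂ] FreeProd B B) (ψ : B →ₗ[ℂ] ℂ) : B →ₗ[ℂ] ℂ :=
  if h : ∃ χ, IsConvExp P Δ ψ χ then h.choose else 0

end Exp

end DualSemi

end

/-!
A letter `a` of a word in `A₁ ⊔ A₂` may be replaced by a matrix `Q ⊗ a` with `Q` a scalar matrix
whose columns sum to `1`: the column sums of a product of such matrices are the product of the
letters, so by naturality `φ₁ ⊙ φ₂` is computed from the functionals `φₖ ∘ colSum`. Write `Q` as a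
sum of more shift units than the word has letters. Each word of the resulting expansion misses one
of the units, hence lives in algebras of matrices on which the column sum has finite-dimensional
range, and there naturality under `a ↦ P_t ⊗ a`, with `P_t` a projection depending affinely on
the values `t` of `φₖ`, shows that the value of `φ₁ ⊙ φ₂` is polynomial in these values. This gives
the existence of `σ`; it is unique, and natural in the algebras, because the characters
`S(φ₁) ⊗ S(φ₂)` separate the points of `S(A₁) ⊗ S(A₂)`.

By the same separation, coassociativity and counit of `Δ` pass to `S(B)`. Convolution with `D(ψ)`
therefore preserves the finite-dimensional space of slices of the comultiplication of an element,
so the exponential series converges. Finally `(M ⨿ M) ∘ T(Δ) = Δ ∘ M`, so that `S(M)` is a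
morphism of coalgebras and both convolution and exponential are compatible with `M`.
-/

noncomputable section

namespace DualSemi

section TensorAlg

variable {V : Type u} [AddCommGroup V] [Module ℂ V]

theorem TAlg.adjoin_range_ι :
    NonUnitalAlgebra.adjoin ℂ (Set.range (TAlg.ι : V →ₗ[ℂ] TAlg V)) = ⊤ := by
  set S := NonUnitalAlgebra.adjoin ℂ (Set.range (TAlg.ι : V →ₗ[ℂ] TAlg V))
  let k : V →ₗ[ℂ] S := TAlg.ι.codRestrict S.toSubmodule fun v =>
    NonUnitalAlgebra.subset_adjoin ℂ ⟨v, rfl⟩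
  let Φ := TensorAlgebra.lift ℂ ((Unitization.inrHom ℂ ℂ S) ∘ₗ k)
  let Ψ : Unitization ℂ S →ₐ[ℂ] TensorAlgebra ℂ V := Unitization.lift
    ((NonUnitalSubalgebraClass.subtype (augKer TensorAlgebra.algebraMapInv)).comp
      (NonUnitalSubalgebraClass.subtype S))
  have Ψ_comp_Φ : Ψ.comp Φ = AlgHom.id ℂ _ := TensorAlgebra.hom_ext <| LinearMap.ext fun v => by
    trans Ψ (Unitization.inr (k v))
    · simp [Φ]
    · change algebraMap ℂ _ 0 + TensorAlgebra.ι ℂ v = TensorAlgebra.ι ℂ v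
      rw [map_zero, zero_add]
  have fst_Φ : (Unitization.fstHom ℂ S).comp Φ = TensorAlgebra.algebraMapInv := by
    ext v
    simp [Φ, algebraMapInv_ι]
  refine eq_top_iff.2 fun x _ => ?_
  have fst_eq_zero : (Φ x.1).fst = 0 := (DFunLike.congr_fun fst_Φ x.1).trans x.2
  have snd_eq : ((Φ x.1).snd : TAlg V) = x := Subtype.ext <|
    calc ((Φ x.1).snd : TAlg V).1
        = algebraMap ℂ _ (Φ x.1).fst + ((Φ x.1).snd : TAlg V).1 := by
          rw [fst_eq_zero, map_zero, zero_add]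
      _ = Ψ (Φ x.1) := rfl
      _ = x.1 := DFunLike.congr_fun Ψ_comp_Φ x.1
  exact snd_eq ▸ (Φ x.1).snd.2

@[elab_as_elim]
theorem TAlg.induction {p : TAlg V → Prop} (ι : ∀ v : V, p (TAlg.ι v))
    (add : ∀ x y : TAlg V, p x → p y → p (x + y)) (mul : ∀ x y : TAlg V, p x → p y → p (x * y))
    (smul : ∀ (c : ℂ) (x : TAlg V), p x → p (c • x)) (x : TAlg V) : p x := by
  have hx : x ∈ NonUnitalAlgebra.adjoin ℂ (Set.range (TAlg.ι : V →ₗ[ℂ] TAlg V)) := by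
    rw [TAlg.adjoin_range_ι]; trivial
  induction hx using NonUnitalAlgebra.adjoin_induction with
  | mem x hx => obtain ⟨v, rfl⟩ := hx; exact ι v
  | add x y _ _ hx hy => exact add x y hx hy
  | zero => exact map_zero (TAlg.ι : V →ₗ[ℂ] TAlg V) ▸ ι 0
  | mul x y _ _ hx hy => exact mul x y hx hy
  | smul c x _ hx => exact smul c x hx

theorem TAlg.hom_ext {A : Type w} [NonUnitalRing A] [Module ℂ A] {f g : TAlg V →ₙₐ[ℂ] A}
    (h : ∀ v, f (TAlg.ι v) = g (TAlg.ι v)) : f = g :=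
  NonUnitalAlgHom.ext fun x => by
    induction x using TAlg.induction with
    | ι v => exact h v
    | add x y hx hy => rw [map_add, map_add, hx, hy]
    | mul x y hx hy => rw [map_mul, map_mul, hx, hy]
    | smul c x hx => rw [map_smul, map_smul, hx]

end TensorAlg

section MulMap

variable {B : Type u} [NonUnitalRing B] [Module ℂ B] [IsScalarTower ℂ B B] [SMulCommClass ℂ B B]

@[simp] theorem mulMap_ι (b : B) : mulMap B (TAlg.ι b) = b := TAlg.lift_ι _ b

theorem mulMap_star [StarRing B] [StarModule ℂ B] (x : TAlg B) :
    mulMap B (star x) = star (mulMap B x) := by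
  induction x using TAlg.induction with
  | ι b => rw [TAlg.star_ι, mulMap_ι, mulMap_ι]
  | add x y hx hy => rw [star_add, map_add, map_add, star_add, hx, hy]
  | mul x y hx hy => rw [star_mul, map_mul, map_mul, star_mul, hx, hy]
  | smul c x hx => rw [star_smul, map_smul, map_smul, star_smul, hx]

end MulMap

section Words

variable {A₁ A₂ : Type u}
  [NonUnitalRing A₁] [Module ℂ A₁] [IsScalarTower ℂ A₁ A₁] [SMulCommClass ℂ A₁ A₁]
  [NonUnitalRing A₂] [Module ℂ A₂] [IsScalarTower ℂ A₂ A₂] [SMulCommClass ℂ A₂ A₂]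

/-- The letters of the alphabet `A₁ ⊕ A₂` as elements of the free product `A₁ ⊔ A₂`. -/
abbrev ofLetter : A₁ ⊕ A₂ → FreeProd A₁ A₂ :=
  Sum.elim (FreeProd.inl A₁ A₂) (FreeProd.inr A₁ A₂)

variable (A₁ A₂) in
/-- The alternating words in the free product `A₁ ⊔ A₂`: the products of non-empty sequences of
letters in which no two neighbours come from the same factor. -/
def alternatingWords : Set (FreeProd A₁ A₂) :=
  {w | ∃ x l, (x :: l).IsChain (fun y z : A₁ ⊕ A₂ => y.isLeft ≠ z.isLeft) ∧
    wordProd ofLetter x l = w}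

theorem letter_mem_alternatingWords (x : A₁ ⊕ A₂) :
    ofLetter x ∈ alternatingWords A₁ A₂ :=
  ⟨x, [], List.isChain_singleton x, rfl⟩

/-- A letter is merged with the first letter of the word if they come from the same factor. -/
theorem letter_mul_mem_alternatingWords (x : A₁ ⊕ A₂) {w : FreeProd A₁ A₂}
    (hw : w ∈ alternatingWords A₁ A₂) :
    ofLetter x * w ∈ alternatingWords A₁ A₂ := by
  obtain ⟨y, l, hl, rfl⟩ := hw
  by_cases hxy : x.isLeft = y.isLeft
  · obtain ⟨z, hz, hzy⟩ : ∃ z : A₁ ⊕ A₂, z.isLeft = y.isLeft ∧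
        ofLetter z = ofLetter x * ofLetter y := by
      rcases x with a | a <;> rcases y with b | b
      · exact ⟨.inl (a * b), rfl, map_mul _ a b⟩
      · cases hxy
      · cases hxy
      · exact ⟨.inr (a * b), rfl, map_mul _ a b⟩
    refine ⟨z, l, ?_, ?_⟩
    · rw [List.isChain_cons] at hl ⊢
      exact ⟨fun v hv => hz ▸ hl.1 v hv, hl.2⟩
    · cases l <;> simp only [wordProd, hzy, mul_assoc]
  · exact ⟨x, y :: l, List.isChain_cons_cons.2 ⟨hxy, hl⟩, rfl⟩

theorem span_alternatingWords : Submodule.span ℂ (alternatingWords A₁ A₂) = ⊤ := by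
  have range_subset : ∀ y ∈ Set.range (FreeProd.inl A₁ A₂) ∪ Set.range (FreeProd.inr A₁ A₂),
      ∃ x, ofLetter x = y := by
    rintro _ (⟨a, rfl⟩ | ⟨b, rfl⟩)
    exacts [⟨.inl a, rfl⟩, ⟨.inr b, rfl⟩]
  rw [eq_top_iff, ← NonUnitalAlgebra.top_toSubmodule, ← FreeProd.adjoin_eq_top,
    NonUnitalAlgebra.adjoin_eq_span]
  refine Submodule.span_mono fun y hy => ?_
  suffices y ∈ alternatingWords A₁ A₂ ∧ ∀ w ∈ alternatingWords A₁ A₂,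
    y * w ∈ alternatingWords A₁ A₂ from this.1
  induction hy using Subsemigroup.closure_induction with
  | mem y hy =>
    obtain ⟨x, rfl⟩ := range_subset y hy
    exact ⟨letter_mem_alternatingWords x, fun w => letter_mul_mem_alternatingWords x⟩
  | mul y z _ _ hy hz =>
    exact ⟨hy.2 z hz.1, fun w hw => mul_assoc y z w ▸ hy.2 _ (hz.2 w hw)⟩

theorem map_wordProd {X D D' : Type u} [Mul D] [Mul D'] {F : Type*} [FunLike F D D']
    [MulHomClass F D D'] (f : F) (h : X → D) (x : X) (l : List X) :
    f (wordProd h x l) = wordProd (f ∘ h) x l := by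
  induction l generalizing x with
  | nil => rfl
  | cons y l ih => rw [wordProd, wordProd, map_mul, ih, Function.comp_apply]

variable {C D : Type u}
  [NonUnitalRing C] [Module ℂ C] [IsScalarTower ℂ C C] [SMulCommClass ℂ C C]
  [NonUnitalRing D] [Module ℂ D] [IsScalarTower ℂ D D] [SMulCommClass ℂ D D]

theorem map_wordMap (h : C →ₙₐ[ℂ] D) (f : A₁ →ₗ[ℂ] C) (g : A₂ →ₗ[ℂ] C)
    (j₁ : A₁ →ₙₐ[ℂ] D) (j₂ : A₂ →ₙₐ[ℂ] D) (hf : ∀ a, h (f a) = j₁ a) (hg : ∀ b, h (g b) = j₂ b)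
    (x : FreeProd A₁ A₂) : h (wordMap f g x) = FreeProd.lift j₁ j₂ x := by
  suffices (h : C →ₗ[ℂ] D) ∘ₗ wordMap f g = (FreeProd.lift j₁ j₂ : FreeProd A₁ A₂ →ₗ[ℂ] D) from
    LinearMap.congr_fun this x
  refine LinearMap.ext_on span_alternatingWords ?_
  rintro _ ⟨y, l, hl, rfl⟩
  have letters : h ∘ Sum.elim f g = FreeProd.lift j₁ j₂ ∘ ofLetter := by
    funext z
    cases z <;> simp [hf, hg]
  change h (wordMap f g _) = FreeProd.lift j₁ j₂ _
  rw [wordMap_word f g y l hl, map_wordProd, map_wordProd, letters]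

theorem map_mulMap_tensorComul (Δ : C →ₙₐ[ℂ] FreeProd C C) (x : TAlg C) :
    FreeProd.map (mulMap C) (mulMap C) (tensorComul Δ x) = Δ (mulMap C x) := by
  suffices (FreeProd.map (mulMap C) (mulMap C)).comp (tensorComul Δ) = Δ.comp (mulMap C) from
    DFunLike.congr_fun this x
  refine TAlg.hom_ext fun b => ?_
  have lift_inl_inr : FreeProd.lift (FreeProd.inl C C) (FreeProd.inr C C)
      = NonUnitalAlgHom.id ℂ (FreeProd C C) :=
    FreeProd.hom_ext (fun a => FreeProd.lift_inl ..) (fun a => FreeProd.lift_inr ..)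
  rw [NonUnitalAlgHom.comp_apply, NonUnitalAlgHom.comp_apply, mulMap_ι, tensorComul, TAlg.lift_ι]
  trans FreeProd.lift (FreeProd.inl C C) (FreeProd.inr C C) (Δ b)
  · exact map_wordMap (FreeProd.map (mulMap C) (mulMap C)) _ _ _ _
      (fun a => by simp [FreeProd.map]) (fun a => by simp [FreeProd.map]) (Δ b)
  · exact DFunLike.congr_fun lift_inl_inr (Δ b)

end Words

section SymmetricAlgebra

variable {V V₁ V₂ W₁ W₂ : Type u} [AddCommGroup V] [Module ℂ V] [AddCommGroup V₁] [Module ℂ V₁]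
  [AddCommGroup V₂] [Module ℂ V₂] [AddCommGroup W₁] [Module ℂ W₁] [AddCommGroup W₂] [Module ℂ W₂]

@[simp] theorem symChar_ι (φ : V →ₗ[ℂ] ℂ) (v : V) :
    symChar φ (SymmetricAlgebra.ι ℂ V v) = φ v :=
  SymmetricAlgebra.lift_ι_apply _ v

/-- After a choice of a basis, `S(V)` is a polynomial algebra and the characters `S(φ)` are the
evaluations, which separate polynomials over an infinite field. -/
theorem eq_zero_of_forall_symChar_eq_zero {c : SymmetricAlgebra ℂ V}
    (h : ∀ φ : V →ₗ[ℂ] ℂ, symChar φ c = 0) : c = 0 := by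
  let b := Module.Basis.ofVectorSpace ℂ V
  let e := SymmetricAlgebra.equivMvPolynomial b
  have aeval_comp_e (x : Module.Basis.ofVectorSpaceIndex ℂ V → ℂ) :
      (MvPolynomial.aeval x).comp (e : SymmetricAlgebra ℂ V →ₐ[ℂ] _) = symChar (b.constr ℂ x) :=
    SymmetricAlgebra.algHom_ext <| b.ext fun i => by
      simp [e, SymmetricAlgebra.equivMvPolynomial_ι_apply]
  refine e.injective (MvPolynomial.funext fun x => ?_)
  calc MvPolynomial.eval x (e c) = symChar (b.constr ℂ x) c :=
        DFunLike.congr_fun (aeval_comp_e x) c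
    _ = MvPolynomial.eval x (e 0) := by rw [h, map_zero, map_zero]

/-- The contraction `id ⊗ g : V₁ ⊗ V₂ → V₁`. -/
def sliceMap (g : V₂ →ₗ[ℂ] ℂ) : V₁ ⊗[ℂ] V₂ →ₗ[ℂ] V₁ :=
  (TensorProduct.rid ℂ V₁).toLinearMap ∘ₗ g.lTensor V₁

@[simp] theorem sliceMap_tmul (g : V₂ →ₗ[ℂ] ℂ) (x : V₁) (y : V₂) :
    sliceMap g (x ⊗ₜ[ℂ] y) = g y • x := by simp [sliceMap]

theorem mul'_comp_map (f : V₁ →ₗ[ℂ] ℂ) (g : V₂ →ₗ[ℂ] ℂ) :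
    LinearMap.mul' ℂ ℂ ∘ₗ TensorProduct.map f g = f ∘ₗ sliceMap g :=
  TensorProduct.ext' fun x y => by simp [mul_comm]

theorem eq_zero_of_forall_sliceMap_eq_zero {z : V₁ ⊗[ℂ] V₂}
    (h : ∀ g : V₂ →ₗ[ℂ] ℂ, sliceMap g z = 0) : z = 0 := by
  classical
  let b := Module.Basis.ofVectorSpace ℂ V₂
  have coeff_eq (k) : LinearMap.comp (Finsupp.lapply k)
      (TensorProduct.equivFinsuppOfBasisRight (M := V₁) b).toLinearMap = sliceMap (b.coord k) :=
    TensorProduct.ext' fun x y => by simp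
  refine (TensorProduct.equivFinsuppOfBasisRight (M := V₁) b).injective (Finsupp.ext fun k => ?_)
  rw [map_zero, Finsupp.zero_apply, ← h (b.coord k)]
  exact LinearMap.congr_fun (coeff_eq k) z

theorem eq_zero_of_forall_mul'_map_eq_zero {I J : Type*} (f : I → V₁ →ₗ[ℂ] ℂ) (g : J → V₂ →ₗ[ℂ] ℂ)
    (hf : ∀ v, (∀ i, f i v = 0) → v = 0) (hg : ∀ v, (∀ j, g j v = 0) → v = 0) {z : V₁ ⊗[ℂ] V₂}
    (h : ∀ i j, LinearMap.mul' ℂ ℂ (TensorProduct.map (f i) (g j) z) = 0) : z = 0 := by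
  have h_left (i : I) : TensorProduct.lid ℂ V₂ ((f i).rTensor V₂ z) = 0 := by
    refine hg _ fun j => ?_
    suffices g j ∘ₗ (TensorProduct.lid ℂ V₂).toLinearMap ∘ₗ (f i).rTensor V₂
        = LinearMap.mul' ℂ ℂ ∘ₗ TensorProduct.map (f i) (g j) from
      (LinearMap.congr_fun this z).trans (h i j)
    exact TensorProduct.ext' fun x y => by simp
  refine eq_zero_of_forall_sliceMap_eq_zero fun ψ => hf _ fun i => ?_
  suffices f i ∘ₗ sliceMap ψ = ψ ∘ₗ (TensorProduct.lid ℂ V₂).toLinearMap ∘ₗ (f i).rTensor V₂ from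
    (LinearMap.congr_fun this z).trans <| by simp [h_left]
  exact TensorProduct.ext' fun x y => by simp [mul_comm]

/-- The character `S(φ₁) ⊗ S(φ₂)` of `S(V₁) ⊗ S(V₂)`. -/
def pairChar (φ₁ : V₁ →ₗ[ℂ] ℂ) (φ₂ : V₂ →ₗ[ℂ] ℂ) :
    SymmetricAlgebra ℂ V₁ ⊗[ℂ] SymmetricAlgebra ℂ V₂ →ₐ[ℂ] ℂ :=
  Algebra.TensorProduct.productMap (symChar φ₁) (symChar φ₂)

@[simp] theorem pairChar_tmul (φ₁ : V₁ →ₗ[ℂ] ℂ) (φ₂ : V₂ →ₗ[ℂ] ℂ) (c : SymmetricAlgebra ℂ V₁)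
    (d : SymmetricAlgebra ℂ V₂) : pairChar φ₁ φ₂ (c ⊗ₜ d) = symChar φ₁ c * symChar φ₂ d :=
  Algebra.TensorProduct.productMap_apply_tmul ..

theorem pairChar_toLinearMap (φ₁ : V₁ →ₗ[ℂ] ℂ) (φ₂ : V₂ →ₗ[ℂ] ℂ) :
    (pairChar φ₁ φ₂).toLinearMap = LinearMap.mul' ℂ ℂ ∘ₗ
      TensorProduct.map (symChar φ₁).toLinearMap (symChar φ₂).toLinearMap :=
  TensorProduct.ext' fun c d => by simp

theorem eq_zero_of_forall_pairChar_eq_zero {z : SymmetricAlgebra ℂ V₁ ⊗[ℂ] SymmetricAlgebra ℂ V₂}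
    (h : ∀ φ₁ φ₂, pairChar φ₁ φ₂ z = 0) : z = 0 :=
  eq_zero_of_forall_mul'_map_eq_zero (fun φ => (symChar φ).toLinearMap)
    (fun φ => (symChar φ).toLinearMap) (fun _ => eq_zero_of_forall_symChar_eq_zero)
    (fun _ => eq_zero_of_forall_symChar_eq_zero) fun φ₁ φ₂ =>
      (LinearMap.congr_fun (pairChar_toLinearMap φ₁ φ₂) z).symm.trans (h φ₁ φ₂)

variable (V₁ V₂) in
/-- The elements of `S(V₁) ⊗ S(V₂)` as functions of pairs of functionals on `V₁` and `V₂`. The range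
is the algebra of polynomial functions of such pairs. -/
def pairEval : SymmetricAlgebra ℂ V₁ ⊗[ℂ] SymmetricAlgebra ℂ V₂ →ₐ[ℂ]
    ((V₁ →ₗ[ℂ] ℂ) × (V₂ →ₗ[ℂ] ℂ) → ℂ) :=
  AlgHom.pi fun τ => pairChar τ.1 τ.2

@[simp] theorem pairEval_apply (z : SymmetricAlgebra ℂ V₁ ⊗[ℂ] SymmetricAlgebra ℂ V₂)
    (τ : (V₁ →ₗ[ℂ] ℂ) × (V₂ →ₗ[ℂ] ℂ)) : pairEval V₁ V₂ z τ = pairChar τ.1 τ.2 z := rfl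

theorem pairEval_injective : Function.Injective (pairEval V₁ V₂) :=
  (injective_iff_map_eq_zero _).2 fun _ hz =>
    eq_zero_of_forall_pairChar_eq_zero fun φ₁ φ₂ => congrFun hz (φ₁, φ₂)

theorem eval_fst_mem_range_pairEval (v : V₁) :
    (fun τ : (V₁ →ₗ[ℂ] ℂ) × (V₂ →ₗ[ℂ] ℂ) => τ.1 v) ∈ (pairEval V₁ V₂).range :=
  ⟨SymmetricAlgebra.ι ℂ V₁ v ⊗ₜ 1, funext fun τ => by simp⟩

theorem eval_snd_mem_range_pairEval (v : V₂) :
    (fun τ : (V₁ →ₗ[ℂ] ℂ) × (V₂ →ₗ[ℂ] ℂ) => τ.2 v) ∈ (pairEval V₁ V₂).range :=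
  ⟨1 ⊗ₜ SymmetricAlgebra.ι ℂ V₂ v, funext fun τ => by simp⟩

/-- The homomorphism `S(j) : S(V₁) → S(V₂)` induced by a linear map `j`. -/
def symMap (j : V₁ →ₗ[ℂ] V₂) : SymmetricAlgebra ℂ V₁ →ₐ[ℂ] SymmetricAlgebra ℂ V₂ :=
  SymmetricAlgebra.lift (SymmetricAlgebra.ι ℂ V₂ ∘ₗ j)

@[simp] theorem symMap_ι (j : V₁ →ₗ[ℂ] V₂) (v : V₁) :
    symMap j (SymmetricAlgebra.ι ℂ V₁ v) = SymmetricAlgebra.ι ℂ V₂ (j v) :=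
  SymmetricAlgebra.lift_ι_apply _ v

theorem symChar_comp_symMap (φ : V₂ →ₗ[ℂ] ℂ) (j : V₁ →ₗ[ℂ] V₂) :
    (symChar φ).comp (symMap j) = symChar (φ ∘ₗ j) :=
  SymmetricAlgebra.algHom_ext <| LinearMap.ext fun v => by simp

theorem symChar_symMap (φ : V₂ →ₗ[ℂ] ℂ) (j : V₁ →ₗ[ℂ] V₂) (c : SymmetricAlgebra ℂ V₁) :
    symChar φ (symMap j c) = symChar (φ ∘ₗ j) c :=
  DFunLike.congr_fun (symChar_comp_symMap φ j) c

theorem symDeriv_comp (ψ : V₂ →ₗ[ℂ] ℂ) (j : V₁ →ₗ[ℂ] V₂) :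
    symDeriv (ψ ∘ₗ j) = symDeriv ψ ∘ₗ (symMap j).toLinearMap := by
  ext c
  change deriv (fun t : ℝ => symChar (t • (ψ ∘ₗ j)) c) 0
    = deriv (fun t : ℝ => symChar (t • ψ) (symMap j c)) 0
  simp only [symChar_symMap, LinearMap.smul_comp]

theorem pairChar_map_symMap (φ₁ : W₁ →ₗ[ℂ] ℂ) (φ₂ : W₂ →ₗ[ℂ] ℂ) (j₁ : V₁ →ₗ[ℂ] W₁)
    (j₂ : V₂ →ₗ[ℂ] W₂) (z : SymmetricAlgebra ℂ V₁ ⊗[ℂ] SymmetricAlgebra ℂ V₂) :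
    pairChar φ₁ φ₂ (Algebra.TensorProduct.map (symMap j₁) (symMap j₂) z)
      = pairChar (φ₁ ∘ₗ j₁) (φ₂ ∘ₗ j₂) z := by
  suffices (pairChar φ₁ φ₂).comp (Algebra.TensorProduct.map (symMap j₁) (symMap j₂))
      = pairChar (φ₁ ∘ₗ j₁) (φ₂ ∘ₗ j₂) from DFunLike.congr_fun this z
  exact Algebra.TensorProduct.ext' fun c d => by simp [symChar_symMap]

end SymmetricAlgebra

section Matrices

open Matrix

variable {n A : Type*} [NonUnitalRing A] [Module ℂ A]

/-- The matrix `Q ⊗ a` with entries `Q i j • a`, as a bilinear function of `Q` and `a`. -/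
def matTensor : Matrix n n ℂ →ₗ[ℂ] A →ₗ[ℂ] Matrix n n A :=
  LinearMap.mk₂ ℂ (fun Q a => Matrix.of fun i j => Q i j • a)
    (fun Q Q' a => Matrix.ext fun i j => add_smul (Q i j) (Q' i j) a)
    (fun c Q a => Matrix.ext fun i j => mul_smul c (Q i j) a)
    (fun Q a a' => Matrix.ext fun i j => smul_add (Q i j) a a')
    (fun c Q a => Matrix.ext fun i j => smul_comm (Q i j) c a)

@[simp] theorem matTensor_apply (Q : Matrix n n ℂ) (a : A) (i j : n) :
    matTensor Q a i j = Q i j • a := rfl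

variable [Fintype n]

/-- The sum of the entries in a column of a matrix over the algebra `A`. -/
def colSum (j : n) : Matrix n n A →ₗ[ℂ] A := ∑ i, Matrix.entryLinearMap ℂ A i j

@[simp] theorem colSum_apply (j : n) (X : Matrix n n A) : colSum j X = ∑ i, X i j := by
  simp [colSum]

variable [IsScalarTower ℂ A A] [SMulCommClass ℂ A A]

theorem matTensor_mul (Q Q' : Matrix n n ℂ) (a a' : A) :
    matTensor (Q * Q') (a * a') = matTensor Q a * matTensor Q' a' := by
  ext i j
  simp [Matrix.mul_apply, Finset.sum_smul, smul_mul_smul_comm]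

/-- The homomorphism `a ↦ Q ⊗ a` for an idempotent matrix `Q`. -/
def matTensorHom (Q : Matrix n n ℂ) (hQ : Q * Q = Q) : A →ₙₐ[ℂ] Matrix n n A where
  toFun := matTensor Q
  map_smul' := map_smul (matTensor Q)
  map_zero' := map_zero (matTensor Q)
  map_add' := map_add (matTensor Q)
  map_mul' a a' := by rw [← matTensor_mul, hQ]

@[simp] theorem matTensorHom_apply (Q : Matrix n n ℂ) (hQ : Q * Q = Q) (a : A) :
    matTensorHom Q hQ a = matTensor Q a := rfl

theorem colSum_comp_lift_matTensor {A : Type u} [NonUnitalRing A] [Module ℂ A]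
    [IsScalarTower ℂ A A] [SMulCommClass ℂ A A] {Q : Matrix n n ℂ} (hQ : ∀ j, ∑ i, Q i j = 1)
    (j : n) :
    colSum j ∘ₗ (TAlg.lift (matTensor (A := A) Q) : TAlg A →ₗ[ℂ] Matrix n n A) = mulMap A := by
  refine LinearMap.ext fun x => ?_
  change colSum j (TAlg.lift (matTensor Q) x) = mulMap A x
  induction x using TAlg.induction generalizing j with
  | ι a => simp [← Finset.sum_smul, hQ]
  | add x y hx hy => rw [map_add, map_add, map_add, hx, hy]
  | mul x y hx hy =>
    simp only [colSum_apply] at hx hy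
    simp only [map_mul, colSum_apply, Matrix.mul_apply]
    rw [Finset.sum_comm]
    simp only [← Finset.sum_mul, hx, ← Finset.mul_sum, hy]
  | smul c x hx => rw [map_smul, map_smul, map_smul, hx]

end Matrices

section PolynomialMaps

variable {T : Type*} (R : Subalgebra ℂ (T → ℂ)) {M M' : Type*} [AddCommGroup M] [Module ℂ M]
  [AddCommGroup M'] [Module ℂ M']

variable (M) in
/-- The functions from `T` to `M` whose coefficients with respect to finitely many vectors belong to
the algebra `R` of scalar functions, that is, the image of `R ⊗ M`. If the functions in `R` are the
polynomial functions on `T`, these are the polynomial functions with values in `M`. -/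
def polyMaps : Submodule ℂ (T → M) :=
  Submodule.span ℂ {F | ∃ r ∈ R, ∃ m, (fun τ => r τ • m) = F}

variable {R}

theorem smul_mem_polyMaps {r : T → ℂ} (hr : r ∈ R) (m : M) : (fun τ => r τ • m) ∈ polyMaps R M :=
  Submodule.subset_span ⟨r, hr, m, rfl⟩

theorem map_mem_polyMaps {Φ : Type*} [FunLike Φ M M'] [LinearMapClass Φ ℂ M M'] (L : Φ)
    {F : T → M} (hF : F ∈ polyMaps R M) : (fun τ => L (F τ)) ∈ polyMaps R M' := by
  suffices polyMaps R M ≤ (polyMaps R M').comap ((L : M →ₗ[ℂ] M').compLeft T) from this hF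
  refine Submodule.span_le.2 ?_
  rintro _ ⟨r, hr, m, rfl⟩
  exact Submodule.subset_span ⟨r, hr, L m, funext fun τ => (map_smul L (r τ) m).symm⟩

theorem mem_of_mem_polyMaps {F : T → ℂ} (hF : F ∈ polyMaps R ℂ) : F ∈ R := by
  suffices polyMaps R ℂ ≤ R.toSubmodule from this hF
  refine Submodule.span_le.2 ?_
  rintro _ ⟨r, hr, c, rfl⟩
  exact R.mul_mem hr (R.algebraMap_mem c)

variable {C : Type*} [NonUnitalRing C] [Module ℂ C] [IsScalarTower ℂ C C] [SMulCommClass ℂ C C]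

theorem mul_mem_polyMaps {F G : T → C} (hF : F ∈ polyMaps R C) (hG : G ∈ polyMaps R C) :
    F * G ∈ polyMaps R C := by
  suffices
      Submodule.map₂ (LinearMap.mul ℂ (T → C)) (polyMaps R C) (polyMaps R C) ≤ polyMaps R C from
    this (Submodule.apply_mem_map₂ _ hF hG)
  rw [polyMaps, Submodule.map₂_span_span, Submodule.span_le]
  rintro _ ⟨_, ⟨r, hr, c, rfl⟩, _, ⟨s, hs, d, rfl⟩, rfl⟩
  exact Submodule.subset_span
    ⟨r * s, R.mul_mem hr hs, c * d, funext fun τ => (smul_mul_smul_comm (r τ) c (s τ) d).symm⟩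

variable {A₁ A₂ : Type u}
  [NonUnitalRing A₁] [Module ℂ A₁] [IsScalarTower ℂ A₁ A₁] [SMulCommClass ℂ A₁ A₁]
  [NonUnitalRing A₂] [Module ℂ A₂] [IsScalarTower ℂ A₂ A₂] [SMulCommClass ℂ A₂ A₂]

theorem lift_mem_polyMaps {f : T → A₁ →ₙₐ[ℂ] C} {g : T → A₂ →ₙₐ[ℂ] C}
    (hf : ∀ a, (fun τ => f τ a) ∈ polyMaps R C) (hg : ∀ b, (fun τ => g τ b) ∈ polyMaps R C)
    (y : FreeProd A₁ A₂) : (fun τ => FreeProd.lift (f τ) (g τ) y) ∈ polyMaps R C := by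
  have hy : y ∈ NonUnitalAlgebra.adjoin ℂ
      (Set.range (FreeProd.inl A₁ A₂) ∪ Set.range (FreeProd.inr A₁ A₂)) := by
    rw [FreeProd.adjoin_eq_top]; trivial
  induction hy using NonUnitalAlgebra.adjoin_induction with
  | mem y hy =>
    rcases hy with ⟨a, rfl⟩ | ⟨b, rfl⟩
    · simpa only [FreeProd.lift_inl] using hf a
    · simpa only [FreeProd.lift_inr] using hg b
  | add y z _ _ hy hz => simp only [map_add]; exact add_mem hy hz
  | zero => simp only [map_zero]; exact zero_mem _
  | mul y z _ _ hy hz => simp only [map_mul]; exact mul_mem_polyMaps hy hz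
  | smul c y _ hy => simp only [map_smul]; exact Submodule.smul_mem _ c hy

end PolynomialMaps

section FiniteRank

variable {A : Type*} [NonUnitalRing A] [Module ℂ A] [IsScalarTower ℂ A A] [SMulCommClass ℂ A A]
  {K : Type*} [Fintype K] [DecidableEq K]

/-- The idempotent matrix whose only non-zero column, the one at `none`, is `(1, t)`. -/
def colProj (t : K → ℂ) : Matrix (Option K) (Option K) ℂ :=
  Matrix.vecMulVec (fun o => o.elim 1 t) (Pi.single none 1)

theorem colProj_mul_self (t : K → ℂ) : colProj t * colProj t = colProj t := by
  simp [colProj, Matrix.vecMulVec_mul_vecMulVec]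

theorem colProj_eq_sum (t : K → ℂ) :
    colProj t = ∑ o, o.elim 1 t • Matrix.single o none 1 := by
  ext i j
  cases i <;> cases j <;>
    simp [colProj, Matrix.vecMulVec_apply, Matrix.sum_apply, Matrix.single_apply]

/-- The homomorphisms `a ↦ colProj t ⊗ a` pull this one functional on matrices back to all the
linear combinations `∑ t k • f k`. -/
def colFunctional (f : K → A →ₗ[ℂ] ℂ) : Matrix (Option K) (Option K) A →ₗ[ℂ] ℂ :=
  ∑ k, f k ∘ₗ Matrix.entryLinearMap ℂ A (some k) none

theorem colFunctional_comp_matTensorHom (f : K → A →ₗ[ℂ] ℂ) (t : K → ℂ) :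
    colFunctional f ∘ₗ (matTensorHom (A := A) (colProj t) (colProj_mul_self t) :
      A →ₗ[ℂ] Matrix (Option K) (Option K) A) = ∑ k, t k • f k := by
  ext a
  simp [colFunctional, colProj, Matrix.vecMulVec_apply]

theorem matTensorHom_colProj_mem_polyMaps {T : Type*} {R : Subalgebra ℂ (T → ℂ)} {t : K → T → ℂ}
    (ht : ∀ k, t k ∈ R) (a : A) :
    (fun τ => matTensorHom (colProj fun k => t k τ) (colProj_mul_self _) a)
      ∈ polyMaps R (Matrix (Option K) (Option K) A) := by
  simp only [matTensorHom_apply, colProj_eq_sum, map_sum, map_smul, LinearMap.sum_apply,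
    LinearMap.smul_apply]
  have sum_mem := (polyMaps R (Matrix (Option K) (Option K) A)).sum_mem (t := Finset.univ)
    fun (o : Option K) _ => smul_mem_polyMaps (r := fun τ => o.elim 1 fun k => t k τ)
      (by cases o; exacts [one_mem R, ht _]) (matTensor (Matrix.single o none 1) a)
  simpa only [Finset.sum_fn] using sum_mem

theorem Independence.prod_sum_smul_mem (P : Independence.{u}) {A₁ A₂ : Type u}
    [NonUnitalRing A₁] [Module ℂ A₁] [IsScalarTower ℂ A₁ A₁] [SMulCommClass ℂ A₁ A₁]
    [NonUnitalRing A₂] [Module ℂ A₂] [IsScalarTower ℂ A₂ A₂] [SMulCommClass ℂ A₂ A₂]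
    {K₁ K₂ : Type} [Fintype K₁] [Fintype K₂] {T : Type*} {R : Subalgebra ℂ (T → ℂ)}
    (f : K₁ → A₁ →ₗ[ℂ] ℂ) (g : K₂ → A₂ →ₗ[ℂ] ℂ) {t : K₁ → T → ℂ} {s : K₂ → T → ℂ}
    (ht : ∀ k, t k ∈ R) (hs : ∀ k, s k ∈ R) (y : FreeProd A₁ A₂) :
    (fun τ => P.prod (∑ k, t k τ • f k) (∑ k, s k τ • g k) y) ∈ R := by
  classical
  refine mem_of_mem_polyMaps ?_
  simp only [← colFunctional_comp_matTensorHom, P.prod_comp]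
  refine map_mem_polyMaps (P.prod (colFunctional f) (colFunctional g))
    (lift_mem_polyMaps (fun a => ?_) (fun b => ?_) y)
  · exact map_mem_polyMaps (FreeProd.inl _ _) (matTensorHom_colProj_mem_polyMaps ht a)
  · exact map_mem_polyMaps (FreeProd.inr _ _) (matTensorHom_colProj_mem_polyMaps hs b)

theorem exists_comp_eq_sum_smul {D V : Type*} [AddCommGroup D] [Module ℂ D] [AddCommGroup V]
    [Module ℂ V] (π : D →ₗ[ℂ] V) [FiniteDimensional ℂ (LinearMap.range π)] :
    ∃ (N : ℕ) (v : Fin N → V) (f : Fin N → D →ₗ[ℂ] ℂ),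
      ∀ φ : V →ₗ[ℂ] ℂ, φ ∘ₗ π = ∑ k, φ (v k) • f k := by
  let b := Module.finBasis ℂ (LinearMap.range π)
  refine ⟨_, fun k => b k, fun k => b.coord k ∘ₗ π.rangeRestrict,
    fun φ => LinearMap.ext fun d => ?_⟩
  have hd : ∑ k, b.repr (π.rangeRestrict d) k • (b k : V) = π d := by
    have sum_repr := congrArg Subtype.val (b.sum_repr (π.rangeRestrict d))
    rwa [Submodule.coe_sum] at sum_repr
  simp only [LinearMap.comp_apply, ← hd, map_sum, map_smul]
  simp [mul_comm]

variable {D₁ D₂ V₁ V₂ : Type u}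
  [NonUnitalRing D₁] [Module ℂ D₁] [IsScalarTower ℂ D₁ D₁] [SMulCommClass ℂ D₁ D₁]
  [NonUnitalRing D₂] [Module ℂ D₂] [IsScalarTower ℂ D₂ D₂] [SMulCommClass ℂ D₂ D₂]
  [AddCommGroup V₁] [Module ℂ V₁] [AddCommGroup V₂] [Module ℂ V₂]

/-- The elements of `D₁ ⊔ D₂` on which the functional `(φ₁ ∘ π₁) ⊙ (φ₂ ∘ π₂)` depends polynomially
on the functionals `φ₁` and `φ₂`. -/
def Independence.polyElements (P : Independence.{u}) (π₁ : D₁ →ₗ[ℂ] V₁) (π₂ : D₂ →ₗ[ℂ] V₂) :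
    Submodule ℂ (FreeProd D₁ D₂) :=
  (pairEval V₁ V₂).range.toSubmodule.comap
    (LinearMap.pi fun τ => P.prod (τ.1 ∘ₗ π₁) (τ.2 ∘ₗ π₂))

theorem Independence.polyElements_eq_top (P : Independence.{u}) (π₁ : D₁ →ₗ[ℂ] V₁)
    (π₂ : D₂ →ₗ[ℂ] V₂) [FiniteDimensional ℂ (LinearMap.range π₁)]
    [FiniteDimensional ℂ (LinearMap.range π₂)] : P.polyElements π₁ π₂ = ⊤ := by
  obtain ⟨_, v₁, f₁, h₁⟩ := exists_comp_eq_sum_smul π₁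
  obtain ⟨_, v₂, f₂, h₂⟩ := exists_comp_eq_sum_smul π₂
  refine eq_top_iff.2 fun y _ => ?_
  change (fun τ : (V₁ →ₗ[ℂ] ℂ) × (V₂ →ₗ[ℂ] ℂ) => P.prod (τ.1 ∘ₗ π₁) (τ.2 ∘ₗ π₂) y)
    ∈ (pairEval V₁ V₂).range
  simp only [h₁, h₂]
  exact P.prod_sum_smul_mem f₁ f₂ (fun k => eval_fst_mem_range_pairEval (v₁ k))
    (fun k => eval_snd_mem_range_pairEval (v₂ k)) y

variable {C₁ C₂ : Type u}
  [NonUnitalRing C₁] [Module ℂ C₁] [IsScalarTower ℂ C₁ C₁] [SMulCommClass ℂ C₁ C₁]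
  [NonUnitalRing C₂] [Module ℂ C₂] [IsScalarTower ℂ C₂ C₂] [SMulCommClass ℂ C₂ C₂]

theorem Independence.map_mem_polyElements (P : Independence.{u}) {π₁ : D₁ →ₗ[ℂ] V₁}
    {π₂ : D₂ →ₗ[ℂ] V₂} (j₁ : C₁ →ₙₐ[ℂ] D₁) (j₂ : C₂ →ₙₐ[ℂ] D₂) {y : FreeProd C₁ C₂} :
    FreeProd.map j₁ j₂ y ∈ P.polyElements π₁ π₂
      ↔ y ∈ P.polyElements (π₁ ∘ₗ (j₁ : C₁ →ₗ[ℂ] D₁)) (π₂ ∘ₗ (j₂ : C₂ →ₗ[ℂ] D₂)) := by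
  simp only [polyElements, Submodule.mem_comap, ← LinearMap.comp_assoc, P.prod_comp]
  rfl

end FiniteRank

section Truncation

open Matrix

variable {A : Type*} [NonUnitalRing A] [Module ℂ A] [IsScalarTower ℂ A A]

section ColStabilizer

variable {n : Type*} [Fintype n]

/-- The matrices whose column `j` lies in the space `C` of columns and which leave `C` invariant.
The column `j` of a product of such matrices is never outside of `C`. -/
def colStabilizer (j : n) (C : Submodule ℂ (n → A)) : NonUnitalSubalgebra ℂ (Matrix n n A) where
  carrier := {X | X.col j ∈ C ∧ ∀ c ∈ C, X *ᵥ c ∈ C}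
  add_mem' {X Y} hX hY :=
    ⟨C.add_mem hX.1 hY.1, fun c hc => add_mulVec X Y c ▸ C.add_mem (hX.2 c hc) (hY.2 c hc)⟩
  zero_mem' := ⟨C.zero_mem, fun c _ => (zero_mulVec c).symm ▸ C.zero_mem⟩
  mul_mem' {X Y} hX hY := ⟨hX.2 _ hY.1, fun c hc => mulVec_mulVec c X Y ▸ hX.2 _ (hY.2 c hc)⟩
  smul_mem' r X hX :=
    ⟨C.smul_mem r hX.1, fun c hc => smul_mulVec r X c ▸ C.smul_mem r (hX.2 c hc)⟩

theorem mem_colStabilizer {j : n} {C : Submodule ℂ (n → A)} {X : Matrix n n A} :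
    X ∈ colStabilizer j C ↔ X.col j ∈ C ∧ ∀ c ∈ C, X *ᵥ c ∈ C := Iff.rfl

instance finiteDimensional_range_colSum (j : n) (C : Submodule ℂ (n → A)) [FiniteDimensional ℂ C] :
    FiniteDimensional ℂ (LinearMap.range (colSum j ∘ₗ
      (NonUnitalSubalgebraClass.subtype (colStabilizer j C) :
        colStabilizer j C →ₗ[ℂ] Matrix n n A))) := by
  let colSumOn : C →ₗ[ℂ] A := (∑ i, LinearMap.proj i) ∘ₗ C.subtype
  refine Submodule.finiteDimensional_of_le (S₂ := LinearMap.range colSumOn) ?_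
  rintro _ ⟨X, rfl⟩
  exact ⟨⟨X.1.col j, X.2.1⟩, by simp [colSumOn]⟩

end ColStabilizer

variable [SMulCommClass ℂ A A]

/-- The span of the products of at least one and at most `m` elements of `V`. -/
def prodSpan (V : Submodule ℂ A) : ℕ → Submodule ℂ A
  | 0 => ⊥
  | m + 1 => V ⊔ Submodule.map₂ (LinearMap.mul ℂ A) V (prodSpan V m)

instance finiteDimensional_prodSpan (V : Submodule ℂ A) [FiniteDimensional ℂ V] (m : ℕ) :
    FiniteDimensional ℂ (prodSpan V m) := by
  induction m with
  | zero => exact inferInstanceAs (FiniteDimensional ℂ (⊥ : Submodule ℂ A))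
  | succ m ih =>
    have hV : V.FG := Module.Finite.iff_fg.1 inferInstance
    exact Module.Finite.iff_fg.2 (hV.sup (hV.map₂ _ (Module.Finite.iff_fg.1 ih)))

variable {N : ℕ}

/-- The matrix unit which moves the position `k` to `k + 1`, modulo `N + 1`. -/
abbrev shiftUnit (k : Fin (N + 1)) : Matrix (Fin (N + 1)) (Fin (N + 1)) ℂ :=
  Matrix.single (k + 1) k 1

theorem sum_shiftUnit_col (j : Fin (N + 1)) :
    ∑ i, (∑ k, shiftUnit k : Matrix (Fin (N + 1)) (Fin (N + 1)) ℂ) i j = 1 := by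
  simp only [Matrix.sum_apply, Matrix.single_apply, ite_and]
  rw [Finset.sum_comm]
  simp

/-- The columns which a product of matrices `shiftUnit k ⊗ a` with `a ∈ V` and `k ≠ k₀` can have at
position `0`: the positions beyond `k₀` are never reached, and the position `i ≤ k₀` is reached
after `i` steps. -/
def truncatedCols (V : Submodule ℂ A) (k₀ : Fin (N + 1)) : Submodule ℂ (Fin (N + 1) → A) :=
  Submodule.pi Set.univ fun i => if i ≤ k₀ then prodSpan V i else ⊥

theorem mem_truncatedCols {V : Submodule ℂ A} {k₀ : Fin (N + 1)} {c : Fin (N + 1) → A} :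
    c ∈ truncatedCols V k₀ ↔ ∀ i, c i ∈ if i ≤ k₀ then prodSpan V i else ⊥ :=
  ⟨fun h i => h i trivial, fun h i _ => h i⟩

instance finiteDimensional_truncatedCols (V : Submodule ℂ A) [FiniteDimensional ℂ V]
    (k₀ : Fin (N + 1)) : FiniteDimensional ℂ (truncatedCols V k₀) := by
  refine Module.Finite.iff_fg.2 (Submodule.fg_pi fun i => ?_)
  split_ifs
  · exact Module.Finite.iff_fg.1 inferInstance
  · exact Submodule.fg_bot

theorem single_mem_truncatedCols {V : Submodule ℂ A} {k k₀ : Fin (N + 1)} (hk : k < k₀) {a : A}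
    (ha : a ∈ prodSpan V (k + 1)) : Pi.single (k + 1) a ∈ truncatedCols V k₀ := by
  have val_succ : (k + 1).val = k.val + 1 := Fin.val_add_one_of_lt (hk.trans_le (Fin.le_last k₀))
  refine mem_truncatedCols.2 fun i => ?_
  rcases eq_or_ne i (k + 1) with rfl | hi
  · have succ_le : k + 1 ≤ k₀ := Fin.le_def.2 (val_succ ▸ hk)
    simpa only [Pi.single_eq_same, if_pos succ_le, val_succ] using ha
  · simp only [Pi.single_eq_of_ne hi, zero_mem]

theorem apply_eq_zero_of_mem_truncatedCols {V : Submodule ℂ A} {k k₀ : Fin (N + 1)} (hk : k₀ < k)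
    {c : Fin (N + 1) → A} (hc : c ∈ truncatedCols V k₀) : c k = 0 := by
  simpa only [if_neg hk.not_ge, Submodule.mem_bot] using mem_truncatedCols.1 hc k

theorem matTensor_shiftUnit_mem_colStabilizer {V : Submodule ℂ A} {a : A} (ha : a ∈ V)
    {k k₀ : Fin (N + 1)} (hk : k ≠ k₀) :
    matTensor (shiftUnit k) a ∈ colStabilizer 0 (truncatedCols V k₀) := by
  have mulVec_eq (c : Fin (N + 1) → A) :
      matTensor (shiftUnit k) a *ᵥ c = Pi.single (k + 1) (a * c k) := by
    ext i
    simp [mulVec, dotProduct, Matrix.single_apply, Pi.single_apply, ite_and, eq_comm]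
  refine mem_colStabilizer.2 ⟨?_, fun c hc => mulVec_eq c ▸ ?_⟩
  · rcases eq_or_ne k 0 with rfl | hk0
    · have col_eq : (matTensor (shiftUnit 0) a).col 0 = Pi.single ((0 : Fin (N + 1)) + 1) a := by
        ext i
        simp [Matrix.single_apply, Pi.single_apply, eq_comm]
      exact col_eq ▸
        single_mem_truncatedCols (Fin.pos_of_ne_zero hk.symm) (Submodule.mem_sup_left ha)
    · have col_eq : (matTensor (shiftUnit k) a).col 0 = 0 := by
        ext i
        simp [hk0]
      exact col_eq ▸ zero_mem _
  · rcases hk.lt_or_gt with hlt | hgt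
    · have apply_mem := mem_truncatedCols.1 hc k
      rw [if_pos hlt.le] at apply_mem
      exact single_mem_truncatedCols hlt
        (Submodule.mem_sup_right (Submodule.apply_mem_map₂ (LinearMap.mul ℂ A) ha apply_mem))
    · rw [apply_eq_zero_of_mem_truncatedCols hgt hc, mul_zero, Pi.single_zero]
      exact zero_mem _

end Truncation

section Polynomiality

theorem wordProd_mem {X D S : Type u} [Mul D] [SetLike S D] [MulMemClass S D] (s : S) {h : X → D}
    {x : X} {l : List X} (hs : ∀ y ∈ x :: l, h y ∈ s) : wordProd h x l ∈ s := by
  induction l generalizing x with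
  | nil => exact hs x (List.mem_singleton_self x)
  | cons y l ih =>
    obtain ⟨hx, hl⟩ := List.forall_mem_cons.1 hs
    exact mul_mem hx (ih hl)

theorem wordProd_sum_mem {X D : Type u} {K : Type} [NonUnitalNonAssocSemiring D] [Fintype K]
    (G : X × K → D) (x : X) (l : List X) (S : AddSubmonoid D)
    (hS : ∀ p m, m.length = l.length → wordProd G p m ∈ S) :
    wordProd (fun y => ∑ k, G (y, k)) x l ∈ S := by
  induction l generalizing x S with
  | nil => exact sum_mem fun k _ => hS (x, k) [] rfl
  | cons y l ih =>
    rw [wordProd, Finset.sum_mul]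
    exact sum_mem fun k _ => ih y (S.comap (AddMonoidHom.mulLeft (G (x, k)))) fun p m hm =>
      hS (x, k) (p :: m) (congrArg (· + 1) hm)

variable {A₁ A₂ : Type u}
  [NonUnitalRing A₁] [Module ℂ A₁] [IsScalarTower ℂ A₁ A₁] [SMulCommClass ℂ A₁ A₁]
  [NonUnitalRing A₂] [Module ℂ A₂] [IsScalarTower ℂ A₂ A₂] [SMulCommClass ℂ A₂ A₂]

/-- The letter `shiftUnit k ⊗ a` of the free product of the matrix algebras, for a letter `a`. -/
def shiftLetter {N : ℕ} (p : (A₁ ⊕ A₂) × Fin (N + 1)) :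
    FreeProd (Matrix (Fin (N + 1)) (Fin (N + 1)) A₁) (Matrix (Fin (N + 1)) (Fin (N + 1)) A₂) :=
  ofLetter (p.1.map (matTensor (shiftUnit p.2)) (matTensor (shiftUnit p.2)))

theorem exists_forall_mem_snd_ne {X : Type*} {N : ℕ} (l : List (X × Fin (N + 1)))
    (hl : l.length ≤ N) : ∃ k₀, ∀ p ∈ l, p.2 ≠ k₀ := by
  have card_lt : (l.map Prod.snd).toFinset.card < (Finset.univ : Finset (Fin (N + 1))).card := by
    have card_le := (l.map Prod.snd).toFinset_card_le
    rw [List.length_map] at card_le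
    simpa using (card_le.trans hl).trans_lt N.lt_succ_self
  obtain ⟨k₀, -, hk₀⟩ := Finset.exists_mem_notMem_of_card_lt_card card_lt
  exact ⟨k₀, fun p hp h => hk₀ (List.mem_toFinset.2 (h ▸ List.mem_map_of_mem hp))⟩

theorem Independence.wordProd_shiftLetter_mem_polyElements (P : Independence.{u}) {N : ℕ}
    (p : (A₁ ⊕ A₂) × Fin (N + 1)) (l : List ((A₁ ⊕ A₂) × Fin (N + 1))) (hl : l.length < N) :
    wordProd shiftLetter p l ∈ P.polyElements (colSum 0) (colSum 0) := by
  obtain ⟨k₀, hk₀⟩ := exists_forall_mem_snd_ne (p :: l) hl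
  let letters := (p :: l).map Prod.fst
  let V₁ : Submodule ℂ A₁ := Submodule.span ℂ (Sum.inl ⁻¹' {x | x ∈ letters})
  let V₂ : Submodule ℂ A₂ := Submodule.span ℂ (Sum.inr ⁻¹' {x | x ∈ letters})
  have : FiniteDimensional ℂ V₁ :=
    FiniteDimensional.span_of_finite ℂ (letters.finite_toSet.preimage Sum.inl_injective.injOn)
  have : FiniteDimensional ℂ V₂ :=
    FiniteDimensional.span_of_finite ℂ (letters.finite_toSet.preimage Sum.inr_injective.injOn)
  let j₁ := NonUnitalSubalgebraClass.subtype (colStabilizer 0 (truncatedCols V₁ k₀))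
  let j₂ := NonUnitalSubalgebraClass.subtype (colStabilizer 0 (truncatedCols V₂ k₀))
  have mem_range : wordProd shiftLetter p l ∈ NonUnitalAlgHom.range (FreeProd.map j₁ j₂) := by
    refine wordProd_mem _ fun q hq => ?_
    have letter_mem : q.1 ∈ letters := List.mem_map_of_mem hq
    obtain ⟨a | b, k⟩ := q
    · have a_mem : a ∈ V₁ := Submodule.subset_span letter_mem
      exact ⟨FreeProd.inl _ _ ⟨_, matTensor_shiftUnit_mem_colStabilizer a_mem (hk₀ _ hq)⟩,
        FreeProd.lift_inl ..⟩
    · have b_mem : b ∈ V₂ := Submodule.subset_span letter_mem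
      exact ⟨FreeProd.inr _ _ ⟨_, matTensor_shiftUnit_mem_colStabilizer b_mem (hk₀ _ hq)⟩,
        FreeProd.lift_inr ..⟩
  obtain ⟨y, hy⟩ := mem_range
  rw [← hy]
  refine (P.map_mem_polyElements j₁ j₂).2 ?_
  rw [P.polyElements_eq_top]
  trivial

/-- The column sums of a product of matrices `Q ⊗ a` are the product of the elements `a`. -/
theorem Independence.wordProd_ofLetter_mem_polyElements (P : Independence.{u}) {n : Type}
    [Fintype n] {Q : Matrix n n ℂ} (hQ : ∀ j, ∑ i, Q i j = 1) (j : n) (x : A₁ ⊕ A₂)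
    (l : List (A₁ ⊕ A₂))
    (h : wordProd (fun y => ofLetter (y.map (matTensor Q) (matTensor Q))) x l
      ∈ P.polyElements (colSum j) (colSum j)) :
    wordProd ofLetter x l ∈ P.polyElements LinearMap.id LinearMap.id := by
  let tensorLetter : A₁ ⊕ A₂ → FreeProd (TAlg A₁) (TAlg A₂) := fun y =>
    ofLetter (y.map TAlg.ι TAlg.ι)
  have map_mulMap : FreeProd.map (mulMap A₁) (mulMap A₂) ∘ tensorLetter = ofLetter := by
    funext y
    cases y <;> simp [tensorLetter, FreeProd.map]
  have map_lift : FreeProd.map (TAlg.lift (matTensor Q)) (TAlg.lift (matTensor Q)) ∘ tensorLetter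
      = fun y => ofLetter (y.map (matTensor Q) (matTensor Q)) := by
    funext y
    cases y <;> simp [tensorLetter, FreeProd.map]
  rw [← map_mulMap, ← map_wordProd, P.map_mem_polyElements, LinearMap.id_comp, LinearMap.id_comp,
    ← colSum_comp_lift_matTensor hQ j, ← colSum_comp_lift_matTensor hQ j,
    ← P.map_mem_polyElements, map_wordProd, map_lift]
  exact h

theorem ofLetter_sum_shiftUnit {N : ℕ} (y : A₁ ⊕ A₂) :
    ofLetter (y.map (matTensor (∑ k : Fin (N + 1), shiftUnit k))
      (matTensor (∑ k : Fin (N + 1), shiftUnit k))) = ∑ k : Fin (N + 1), shiftLetter (y, k) := by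
  cases y <;> simp [shiftLetter]

theorem Independence.polyElements_id_eq_top (P : Independence.{u}) :
    P.polyElements (LinearMap.id : A₁ →ₗ[ℂ] A₁) (LinearMap.id : A₂ →ₗ[ℂ] A₂) = ⊤ := by
  rw [eq_top_iff, ← span_alternatingWords, Submodule.span_le]
  rintro _ ⟨x, l, -, rfl⟩
  have word_mem (p : (A₁ ⊕ A₂) × Fin (l.length + 1 + 1)) (m) (hm : m.length = l.length) :
      wordProd shiftLetter p m ∈ P.polyElements (colSum 0) (colSum 0) :=
    P.wordProd_shiftLetter_mem_polyElements p m (Nat.lt_succ_of_le hm.le)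
  refine P.wordProd_ofLetter_mem_polyElements (sum_shiftUnit_col (N := l.length + 1)) 0 x l ?_
  simp only [ofLetter_sum_shiftUnit]
  exact wordProd_sum_mem shiftLetter x l (P.polyElements _ _).toAddSubmonoid word_mem

end Polynomiality

section Sigma

variable {A₁ A₂ : Type u}
  [NonUnitalRing A₁] [Module ℂ A₁] [IsScalarTower ℂ A₁ A₁] [SMulCommClass ℂ A₁ A₁]
  [NonUnitalRing A₂] [Module ℂ A₂] [IsScalarTower ℂ A₂ A₂] [SMulCommClass ℂ A₂ A₂]

theorem Independence.prod_mem_range_pairEval (P : Independence.{u}) (x : FreeProd A₁ A₂) :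
    (fun τ : (A₁ →ₗ[ℂ] ℂ) × (A₂ →ₗ[ℂ] ℂ) => P.prod τ.1 τ.2 x)
      ∈ LinearMap.range (pairEval A₁ A₂).toLinearMap :=
  (P.polyElements_id_eq_top.ge trivial : x ∈ P.polyElements LinearMap.id LinearMap.id)

/-- The map `σ : A₁ ⊔ A₂ → S(A₁) ⊗ S(A₂)` of an independence, which sends `x` to the polynomial
function `(φ₁, φ₂) ↦ (φ₁ ⊙ φ₂)(x)`. -/
def Independence.sigma (P : Independence.{u}) :
    FreeProd A₁ A₂ →ₗ[ℂ] SymmetricAlgebra ℂ A₁ ⊗[ℂ] SymmetricAlgebra ℂ A₂ :=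
  (LinearEquiv.ofInjective (pairEval A₁ A₂).toLinearMap pairEval_injective).symm ∘ₗ
    (LinearMap.pi fun τ : (A₁ →ₗ[ℂ] ℂ) × (A₂ →ₗ[ℂ] ℂ) => P.prod τ.1 τ.2).codRestrict _
      P.prod_mem_range_pairEval

theorem Independence.pairChar_sigma (P : Independence.{u}) (φ₁ : A₁ →ₗ[ℂ] ℂ) (φ₂ : A₂ →ₗ[ℂ] ℂ)
    (x : FreeProd A₁ A₂) : pairChar φ₁ φ₂ (P.sigma x) = P.prod φ₁ φ₂ x :=
  congrFun (congrArg Subtype.val <|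
    (LinearEquiv.ofInjective (pairEval A₁ A₂).toLinearMap pairEval_injective).apply_symm_apply
      ⟨_, P.prod_mem_range_pairEval x⟩) (φ₁, φ₂)

theorem isSigma_iff {P : Independence.{u}}
    {σ : FreeProd A₁ A₂ →ₗ[ℂ] SymmetricAlgebra ℂ A₁ ⊗[ℂ] SymmetricAlgebra ℂ A₂} :
    IsSigma P σ ↔ ∀ φ₁ φ₂ x, pairChar φ₁ φ₂ (σ x) = P.prod φ₁ φ₂ x :=
  forall₂_congr fun φ₁ φ₂ => by
    rw [← LinearMap.comp_assoc, ← pairChar_toLinearMap, eq_comm]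
    exact LinearMap.ext_iff

theorem Independence.isSigma_sigma (P : Independence.{u}) :
    IsSigma P (P.sigma (A₁ := A₁) (A₂ := A₂)) :=
  isSigma_iff.2 P.pairChar_sigma

theorem IsSigma.unique {P : Independence.{u}}
    {σ σ' : FreeProd A₁ A₂ →ₗ[ℂ] SymmetricAlgebra ℂ A₁ ⊗[ℂ] SymmetricAlgebra ℂ A₂}
    (hσ : IsSigma P σ) (hσ' : IsSigma P σ') : σ = σ' :=
  LinearMap.ext fun x => pairEval_injective <| funext fun _ =>
    (isSigma_iff.1 hσ _ _ x).trans (isSigma_iff.1 hσ' _ _ x).symm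

theorem IsSigma.map {C₁ C₂ : Type u}
    [NonUnitalRing C₁] [Module ℂ C₁] [IsScalarTower ℂ C₁ C₁] [SMulCommClass ℂ C₁ C₁]
    [NonUnitalRing C₂] [Module ℂ C₂] [IsScalarTower ℂ C₂ C₂] [SMulCommClass ℂ C₂ C₂]
    {P : Independence.{u}}
    {σ : FreeProd A₁ A₂ →ₗ[ℂ] SymmetricAlgebra ℂ A₁ ⊗[ℂ] SymmetricAlgebra ℂ A₂}
    {σ' : FreeProd C₁ C₂ →ₗ[ℂ] SymmetricAlgebra ℂ C₁ ⊗[ℂ] SymmetricAlgebra ℂ C₂}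
    (hσ : IsSigma P σ) (hσ' : IsSigma P σ') (j₁ : A₁ →ₙₐ[ℂ] C₁) (j₂ : A₂ →ₙₐ[ℂ] C₂)
    (x : FreeProd A₁ A₂) :
    Algebra.TensorProduct.map (symMap (j₁ : A₁ →ₗ[ℂ] C₁)) (symMap (j₂ : A₂ →ₗ[ℂ] C₂)) (σ x)
      = σ' (FreeProd.map j₁ j₂ x) :=
  pairEval_injective <| funext fun τ => by
    rw [pairEval_apply, pairEval_apply, pairChar_map_symMap, isSigma_iff.1 hσ, isSigma_iff.1 hσ',
      P.prod_comp]
    rfl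

end Sigma

section Slices

variable {C D : Type u} [AddCommGroup C] [Module ℂ C] [AddCommGroup D] [Module ℂ D]

/-- The space of all contractions `(id ⊗ g)(z)` of a tensor `z`. -/
def slices (z : C ⊗[ℂ] D) : Submodule ℂ C :=
  LinearMap.range
    ({ toFun := fun g => sliceMap g z
       map_add' := fun g g' => by simp [sliceMap, LinearMap.lTensor_add]
       map_smul' := fun r g => by simp [sliceMap, LinearMap.lTensor_smul] } :
      (D →ₗ[ℂ] ℂ) →ₗ[ℂ] C)

theorem mem_slices {z : C ⊗[ℂ] D} {c : C} : c ∈ slices z ↔ ∃ g : D →ₗ[ℂ] ℂ, sliceMap g z = c :=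
  Iff.rfl

instance finiteDimensional_slices (z : C ⊗[ℂ] D) : FiniteDimensional ℂ (slices z) := by
  suffices ∃ W : Submodule ℂ C, FiniteDimensional ℂ W ∧ ∀ g : D →ₗ[ℂ] ℂ, sliceMap g z ∈ W by
    obtain ⟨W, _, hW⟩ := this
    exact Submodule.finiteDimensional_of_le (S₂ := W) (by rintro _ ⟨g, rfl⟩; exact hW g)
  induction z with
  | zero => exact ⟨⊥, inferInstance, fun g => by simp⟩
  | tmul x y =>
    refine ⟨Submodule.span ℂ {x}, inferInstance, fun g => ?_⟩
    rw [sliceMap_tmul]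
    exact Submodule.smul_mem _ _ (Submodule.mem_span_singleton_self x)
  | add x y hx hy =>
    obtain ⟨W, _, hx⟩ := hx
    obtain ⟨W', _, hy⟩ := hy
    refine ⟨W ⊔ W', inferInstance, fun g => ?_⟩
    rw [map_add]
    exact Submodule.add_mem_sup (hx g) (hy g)

end Slices

section CoalgebraExp

variable {C D : Type u} [AddCommGroup C] [Module ℂ C] [AddCommGroup D] [Module ℂ D]
  {Δ : C →ₗ[ℂ] C ⊗[ℂ] C} {δ F : C →ₗ[ℂ] ℂ}

theorem summable_inv_factorial_mul_pow {W : Type*} [AddCommGroup W] [Module ℂ W]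
    [FiniteDimensional ℂ W] (T : Module.End ℂ W) (f : Module.End ℂ W →ₗ[ℂ] ℂ) :
    Summable fun n : ℕ => (n.factorial : ℂ)⁻¹ * f (T ^ n) := by
  let e := ((Module.finBasis ℂ W).equivFun.conjAlgEquiv ℂ).trans
    (Module.End.toContinuousLinearMap (Fin (Module.finrank ℂ W) → ℂ))
  let g := LinearMap.toContinuousLinearMap (f ∘ₗ e.symm.toLinearMap)
  refine (g.summable (NormedSpace.expSeries_summable' (𝕂 := ℂ) (e T))).congr fun n => ?_
  simp [g, ← map_pow]

theorem coalgPow_eq_comp_pow (Δ : C →ₗ[ℂ] C ⊗[ℂ] C) (δ F : C →ₗ[ℂ] ℂ) (n : ℕ) :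
    coalgPow Δ δ F n = δ ∘ₗ ((sliceMap F ∘ₗ Δ) ^ n : Module.End ℂ C) := by
  induction n with
  | zero => rfl
  | succ n ih =>
    rw [coalgPow, ← LinearMap.comp_assoc, mul'_comp_map, ih, pow_succ]
    rfl

theorem sliceMap_apply_sliceMap (F : C →ₗ[ℂ] ℂ) (g : D →ₗ[ℂ] ℂ) (z : C ⊗[ℂ] D) :
    sliceMap F (Δ (sliceMap g z))
      = sliceMap (LinearMap.mul' ℂ ℂ ∘ₗ TensorProduct.map F g)
        (TensorProduct.assoc ℂ C C D (Δ.rTensor D z)) := by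
  suffices (sliceMap F ∘ₗ Δ) ∘ₗ sliceMap g
      = sliceMap (LinearMap.mul' ℂ ℂ ∘ₗ TensorProduct.map F g) ∘ₗ
        (TensorProduct.assoc ℂ C C D).toLinearMap ∘ₗ Δ.rTensor D from LinearMap.congr_fun this z
  refine TensorProduct.ext' fun x y => ?_
  simp only [LinearMap.comp_apply, sliceMap_tmul, map_smul, LinearMap.rTensor_tmul,
    LinearEquiv.coe_coe]
  induction Δ x with
  | zero => simp
  | tmul p q => simp [smul_smul, mul_comm]
  | add p q hp hq => simp only [map_add, smul_add, hp, hq, TensorProduct.add_tmul]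

/-- The convolution operator `sliceMap F ∘ Δ` therefore acts on a finite-dimensional space
containing a given `c`, which makes the exponential series converge. -/
theorem sliceMap_mem_slices_of_coassoc
    (hΔ : ∀ c, TensorProduct.assoc ℂ C C C (Δ.rTensor C (Δ c)) = Δ.lTensor C (Δ c))
    (F : C →ₗ[ℂ] ℂ) {c x : C} (hx : x ∈ slices (Δ c)) : sliceMap F (Δ x) ∈ slices (Δ c) := by
  obtain ⟨g, rfl⟩ := mem_slices.1 hx
  refine mem_slices.2 ⟨LinearMap.mul' ℂ ℂ ∘ₗ TensorProduct.map F g ∘ₗ Δ, ?_⟩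
  rw [sliceMap_apply_sliceMap, hΔ]
  simp only [sliceMap, LinearMap.comp_apply, LinearMap.lTensor_comp_apply]

theorem summable_coalgPow
    (hΔ : ∀ c, TensorProduct.assoc ℂ C C C (Δ.rTensor C (Δ c)) = Δ.lTensor C (Δ c))
    (hδ : ∀ c, sliceMap δ (Δ c) = c) (F : C →ₗ[ℂ] ℂ) (c : C) :
    Summable fun n : ℕ => (n.factorial : ℂ)⁻¹ * coalgPow Δ δ F n c := by
  let c' : slices (Δ c) := ⟨c, mem_slices.2 ⟨δ, hδ c⟩⟩
  let T : Module.End ℂ (slices (Δ c)) :=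
    LinearMap.restrict (sliceMap F ∘ₗ Δ) fun x hx => sliceMap_mem_slices_of_coassoc hΔ F hx
  refine (summable_inv_factorial_mul_pow T
    (δ ∘ₗ (slices (Δ c)).subtype ∘ₗ LinearMap.applyₗ c')).congr fun n => ?_
  rw [coalgPow_eq_comp_pow, LinearMap.comp_apply, LinearMap.comp_apply,
    LinearMap.applyₗ_apply_apply, Module.End.pow_restrict]
  rfl

theorem exists_isCoalgExp
    (hΔ : ∀ c, TensorProduct.assoc ℂ C C C (Δ.rTensor C (Δ c)) = Δ.lTensor C (Δ c))
    (hδ : ∀ c, sliceMap δ (Δ c) = c) (F : C →ₗ[ℂ] ℂ) : ∃ E, IsCoalgExp Δ δ F E := by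
  have hs := summable_coalgPow hΔ hδ F
  refine ⟨{ toFun := fun c => ∑' n : ℕ, (n.factorial : ℂ)⁻¹ * coalgPow Δ δ F n c
            map_add' := fun x y => ?_
            map_smul' := fun r x => ?_ }, fun c => (hs c).hasSum⟩
  · rw [← (hs x).tsum_add (hs y)]
    simp only [map_add, mul_add]
  · rw [RingHom.id_apply, smul_eq_mul, ← tsum_mul_left]
    simp only [map_smul, smul_eq_mul, mul_left_comm]

theorem IsCoalgExp.unique {E E' : C →ₗ[ℂ] ℂ} (h : IsCoalgExp Δ δ F E)
    (h' : IsCoalgExp Δ δ F E') : E = E' :=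
  LinearMap.ext fun c => (h c).unique (h' c)

theorem coalgPow_comp {Δ' : D →ₗ[ℂ] D ⊗[ℂ] D} (δ F : C →ₗ[ℂ] ℂ) (f : D →ₗ[ℂ] C)
    (hf : TensorProduct.map f f ∘ₗ Δ' = Δ ∘ₗ f) (n : ℕ) :
    coalgPow Δ' (δ ∘ₗ f) (F ∘ₗ f) n = coalgPow Δ δ F n ∘ₗ f := by
  induction n with
  | zero => rfl
  | succ n ih =>
    rw [coalgPow, coalgPow, ih, TensorProduct.map_comp, LinearMap.comp_assoc, hf]
    rfl

theorem IsCoalgExp.comp {Δ' : D →ₗ[ℂ] D ⊗[ℂ] D} {E : C →ₗ[ℂ] ℂ} (h : IsCoalgExp Δ δ F E)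
    (f : D →ₗ[ℂ] C) (hf : TensorProduct.map f f ∘ₗ Δ' = Δ ∘ₗ f) :
    IsCoalgExp Δ' (δ ∘ₗ f) (F ∘ₗ f) (E ∘ₗ f) := fun d => by
  simp only [coalgPow_comp δ F f hf]
  exact h (f d)

end CoalgebraExp

section Convolution

theorem symComul_ι {B : Type u} [NonUnitalRing B] [Module ℂ B]
    (σ : FreeProd B B →ₗ[ℂ] SymmetricAlgebra ℂ B ⊗[ℂ] SymmetricAlgebra ℂ B)
    (Δ : B →ₙₐ[ℂ] FreeProd B B) (b : B) :
    symComul σ Δ (SymmetricAlgebra.ι ℂ B b) = σ (Δ b) :=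
  SymmetricAlgebra.lift_ι_apply _ b

variable {B B' : Type u}
  [NonUnitalRing B] [Module ℂ B] [IsScalarTower ℂ B B] [SMulCommClass ℂ B B]
  [NonUnitalRing B'] [Module ℂ B'] [IsScalarTower ℂ B' B'] [SMulCommClass ℂ B' B']
  {P : Independence.{u}} {Δ : B →ₙₐ[ℂ] FreeProd B B} {Δ' : B' →ₙₐ[ℂ] FreeProd B' B'}
  {σ : FreeProd B B →ₗ[ℂ] SymmetricAlgebra ℂ B ⊗[ℂ] SymmetricAlgebra ℂ B}
  {σ' : FreeProd B' B' →ₗ[ℂ] SymmetricAlgebra ℂ B' ⊗[ℂ] SymmetricAlgebra ℂ B'}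

theorem conv_comp (φ₁ φ₂ : B →ₗ[ℂ] ℂ) (j : B' →ₙₐ[ℂ] B)
    (hj : ∀ x, FreeProd.map j j (Δ' x) = Δ (j x)) :
    conv P Δ' (φ₁ ∘ₗ (j : B' →ₗ[ℂ] B)) (φ₂ ∘ₗ (j : B' →ₗ[ℂ] B))
      = conv P Δ φ₁ φ₂ ∘ₗ (j : B' →ₗ[ℂ] B) := by
  rw [conv, P.prod_comp]
  exact LinearMap.ext fun x => congrArg (P.prod φ₁ φ₂) (hj x)

theorem conv_assoc
    (hΔ : ∀ b, FreeProd.assoc B B B (FreeProd.map Δ (NonUnitalAlgHom.id ℂ B) (Δ b))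
      = FreeProd.map (NonUnitalAlgHom.id ℂ B) Δ (Δ b)) (φ₁ φ₂ φ₃ : B →ₗ[ℂ] ℂ) :
    conv P Δ (conv P Δ φ₁ φ₂) φ₃ = conv P Δ φ₁ (conv P Δ φ₂ φ₃) := by
  ext b
  calc P.prod (conv P Δ φ₁ φ₂) φ₃ (Δ b)
      = P.prod (P.prod φ₁ φ₂) φ₃ (FreeProd.map Δ (NonUnitalAlgHom.id ℂ B) (Δ b)) :=
        DFunLike.congr_fun (P.prod_comp (P.prod φ₁ φ₂) φ₃ Δ (NonUnitalAlgHom.id ℂ B)) (Δ b)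
    _ = P.prod φ₁ (P.prod φ₂ φ₃) (FreeProd.map (NonUnitalAlgHom.id ℂ B) Δ (Δ b)) := by
        rw [P.prod_assoc, hΔ]
    _ = P.prod φ₁ (conv P Δ φ₂ φ₃) (Δ b) :=
        (DFunLike.congr_fun (P.prod_comp φ₁ (P.prod φ₂ φ₃) (NonUnitalAlgHom.id ℂ B) Δ) (Δ b)).symm

theorem Independence.prod_zero_right (P : Independence.{u}) (φ : B →ₗ[ℂ] ℂ)
    (x : FreeProd B B') : P.prod φ (0 : B' →ₗ[ℂ] ℂ) x
      = φ (FreeProd.lift (NonUnitalAlgHom.id ℂ B) (0 : B' →ₙₐ[ℂ] B) x) := by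
  have map_id_zero : FreeProd.map (NonUnitalAlgHom.id ℂ B) (0 : B' →ₙₐ[ℂ] B')
      = (FreeProd.inl B B').comp (FreeProd.lift (NonUnitalAlgHom.id ℂ B) 0) :=
    FreeProd.hom_ext (fun a => by simp [FreeProd.map]) (fun b => by simp [FreeProd.map])
  calc P.prod φ (0 : B' →ₗ[ℂ] ℂ) x
      = P.prod φ (0 : B' →ₗ[ℂ] ℂ) (FreeProd.map (NonUnitalAlgHom.id ℂ B) 0 x) :=
        DFunLike.congr_fun (P.prod_comp φ 0 (NonUnitalAlgHom.id ℂ B) (0 : B' →ₙₐ[ℂ] B')) x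
    _ = φ (FreeProd.lift (NonUnitalAlgHom.id ℂ B) 0 x) := by
        rw [map_id_zero, NonUnitalAlgHom.comp_apply, P.prod_inl]

theorem conv_zero
    (hΔ : ∀ b, FreeProd.lift (NonUnitalAlgHom.id ℂ B) (0 : B →ₙₐ[ℂ] B) (Δ b) = b)
    (φ : B →ₗ[ℂ] ℂ) : conv P Δ φ 0 = φ :=
  LinearMap.ext fun b => (P.prod_zero_right φ (Δ b)).trans (congrArg φ (hΔ b))

theorem pairChar_symComul (hσ : IsSigma P σ) (φ₁ φ₂ : B →ₗ[ℂ] ℂ) (c : SymmetricAlgebra ℂ B) :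
    pairChar φ₁ φ₂ (symComul σ Δ c) = symChar (conv P Δ φ₁ φ₂) c := by
  suffices (pairChar φ₁ φ₂).comp (symComul σ Δ) = symChar (conv P Δ φ₁ φ₂) from
    DFunLike.congr_fun this c
  refine SymmetricAlgebra.algHom_ext (LinearMap.ext fun b => ?_)
  simp [symComul_ι, isSigma_iff.1 hσ, conv]

theorem map_symChar_pairChar_assoc_rTensor_symComul (hσ : IsSigma P σ) (φ₁ φ₂ φ₃ : B →ₗ[ℂ] ℂ)
    (z : SymmetricAlgebra ℂ B ⊗[ℂ] SymmetricAlgebra ℂ B) :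
    LinearMap.mul' ℂ ℂ
      (TensorProduct.map (symChar φ₁).toLinearMap (pairChar φ₂ φ₃).toLinearMap
        (TensorProduct.assoc ℂ _ _ _ ((symComul σ Δ).toLinearMap.rTensor _ z)))
      = pairChar (conv P Δ φ₁ φ₂) φ₃ z := by
  induction z with
  | zero => simp
  | add x y hx hy => simp only [map_add, hx, hy]
  | tmul x y =>
    simp only [LinearMap.rTensor_tmul, AlgHom.toLinearMap_apply, pairChar_tmul,
      ← pairChar_symComul hσ]
    induction symComul σ Δ x with
    | zero => simp
    | tmul p q => simp [mul_assoc]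
    | add p q hp hq => simp only [map_add, hp, hq, TensorProduct.add_tmul, add_mul]

theorem map_symChar_pairChar_lTensor_symComul (hσ : IsSigma P σ) (φ₁ φ₂ φ₃ : B →ₗ[ℂ] ℂ)
    (z : SymmetricAlgebra ℂ B ⊗[ℂ] SymmetricAlgebra ℂ B) :
    LinearMap.mul' ℂ ℂ
      (TensorProduct.map (symChar φ₁).toLinearMap (pairChar φ₂ φ₃).toLinearMap
        ((symComul σ Δ).toLinearMap.lTensor _ z))
      = pairChar φ₁ (conv P Δ φ₂ φ₃) z := by
  induction z with
  | zero => simp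
  | add x y hx hy => simp only [map_add, hx, hy]
  | tmul x y => simp [pairChar_symComul hσ]

theorem symComul_coassoc (hσ : IsSigma P σ)
    (h : ∀ φ₁ φ₂ φ₃, conv P Δ (conv P Δ φ₁ φ₂) φ₃ = conv P Δ φ₁ (conv P Δ φ₂ φ₃))
    (c : SymmetricAlgebra ℂ B) :
    TensorProduct.assoc ℂ _ _ _ ((symComul σ Δ).toLinearMap.rTensor _ (symComul σ Δ c))
      = (symComul σ Δ).toLinearMap.lTensor _ (symComul σ Δ c) := by
  rw [← sub_eq_zero]
  refine eq_zero_of_forall_mul'_map_eq_zero (fun φ => (symChar φ).toLinearMap)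
    (fun τ : (B →ₗ[ℂ] ℂ) × (B →ₗ[ℂ] ℂ) => (pairChar τ.1 τ.2).toLinearMap)
    (fun _ => eq_zero_of_forall_symChar_eq_zero)
    (fun _ hz => eq_zero_of_forall_pairChar_eq_zero fun φ₁ φ₂ => hz (φ₁, φ₂)) fun φ₁ τ => ?_
  rw [map_sub, map_sub, map_symChar_pairChar_assoc_rTensor_symComul hσ,
    map_symChar_pairChar_lTensor_symComul hσ, pairChar_symComul hσ, pairChar_symComul hσ, h,
    sub_self]

theorem symComul_counit (hσ : IsSigma P σ) (h : ∀ φ, conv P Δ φ 0 = φ)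
    (c : SymmetricAlgebra ℂ B) :
    sliceMap (symChar (0 : B →ₗ[ℂ] ℂ)).toLinearMap (symComul σ Δ c) = c := by
  rw [← sub_eq_zero]
  refine eq_zero_of_forall_symChar_eq_zero fun φ => ?_
  have symChar_sliceMap : (symChar φ).toLinearMap ∘ₗ
      sliceMap (symChar (0 : B →ₗ[ℂ] ℂ)).toLinearMap = (pairChar φ 0).toLinearMap := by
    rw [← mul'_comp_map, pairChar_toLinearMap]
  rw [map_sub, sub_eq_zero]
  calc symChar φ (sliceMap (symChar (0 : B →ₗ[ℂ] ℂ)).toLinearMap (symComul σ Δ c))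
      = pairChar φ 0 (symComul σ Δ c) := LinearMap.congr_fun symChar_sliceMap _
    _ = symChar φ c := by rw [pairChar_symComul hσ, h]

theorem symComul_symMap (hσ : IsSigma P σ) (hσ' : IsSigma P σ') (j : B' →ₙₐ[ℂ] B)
    (hj : ∀ x, FreeProd.map j j (Δ' x) = Δ (j x)) :
    TensorProduct.map (symMap (j : B' →ₗ[ℂ] B)).toLinearMap (symMap (j : B' →ₗ[ℂ] B)).toLinearMap
      ∘ₗ (symComul σ' Δ').toLinearMap
      = (symComul σ Δ).toLinearMap ∘ₗ (symMap (j : B' →ₗ[ℂ] B)).toLinearMap := by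
  suffices (Algebra.TensorProduct.map (symMap (j : B' →ₗ[ℂ] B)) (symMap (j : B' →ₗ[ℂ] B))).comp
      (symComul σ' Δ') = (symComul σ Δ).comp (symMap (j : B' →ₗ[ℂ] B)) from
    congrArg AlgHom.toLinearMap this
  refine SymmetricAlgebra.algHom_ext (LinearMap.ext fun x => ?_)
  simp [symComul_ι, hσ'.map hσ, hj]

theorem IsConvExp.unique {ψ χ χ' : B →ₗ[ℂ] ℂ} (h : IsConvExp P Δ ψ χ)
    (h' : IsConvExp P Δ ψ χ') : χ = χ' := by
  obtain ⟨σ, E, hσ, hE, rfl⟩ := h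
  obtain ⟨σ', E', hσ', hE', rfl⟩ := h'
  obtain rfl := hσ.unique hσ'
  rw [hE.unique hE']

theorem IsConvExp.convExp_eq {ψ χ : B →ₗ[ℂ] ℂ} (h : IsConvExp P Δ ψ χ) : convExp P Δ ψ = χ := by
  have exists_convExp : ∃ χ, IsConvExp P Δ ψ χ := ⟨χ, h⟩
  rw [convExp, dif_pos exists_convExp]
  exact exists_convExp.choose_spec.unique h

theorem IsConvExp.comp {ψ χ : B →ₗ[ℂ] ℂ} (h : IsConvExp P Δ ψ χ) (j : B' →ₙₐ[ℂ] B)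
    (hj : ∀ x, FreeProd.map j j (Δ' x) = Δ (j x)) :
    IsConvExp P Δ' (ψ ∘ₗ (j : B' →ₗ[ℂ] B)) (χ ∘ₗ (j : B' →ₗ[ℂ] B)) := by
  obtain ⟨σ, E, hσ, hE, rfl⟩ := h
  refine ⟨P.sigma, E ∘ₗ (symMap (j : B' →ₗ[ℂ] B)).toLinearMap, P.isSigma_sigma, ?_,
    LinearMap.ext fun x => by simp⟩
  have counit_comp : (symChar (0 : B →ₗ[ℂ] ℂ)).toLinearMap ∘ₗ (symMap (j : B' →ₗ[ℂ] B)).toLinearMap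
      = (symChar (0 : B' →ₗ[ℂ] ℂ)).toLinearMap :=
    LinearMap.ext fun c => by simp [symChar_symMap]
  rw [symDeriv_comp, ← counit_comp]
  exact hE.comp _ (symComul_symMap hσ P.isSigma_sigma j hj)

theorem exists_isConvExp (P : Independence.{u})
    (coassoc : ∀ b, FreeProd.assoc B B B (FreeProd.map Δ (NonUnitalAlgHom.id ℂ B) (Δ b))
      = FreeProd.map (NonUnitalAlgHom.id ℂ B) Δ (Δ b))
    (counit_right : ∀ b, FreeProd.lift (NonUnitalAlgHom.id ℂ B) (0 : B →ₙₐ[ℂ] B) (Δ b) = b)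
    (ψ : B →ₗ[ℂ] ℂ) : ∃ χ, IsConvExp P Δ ψ χ := by
  obtain ⟨E, hE⟩ := exists_isCoalgExp (symComul_coassoc P.isSigma_sigma (conv_assoc coassoc))
    (symComul_counit P.isSigma_sigma (conv_zero counit_right)) (symDeriv ψ)
  exact ⟨_, P.sigma, E, P.isSigma_sigma, hE, rfl⟩

end Convolution

end DualSemi

end

theorem mainTheorem6_general {B B' : Type u}
    [NonUnitalRing B] [Module ℂ B] [IsScalarTower ℂ B B] [SMulCommClass ℂ B B]
    [NonUnitalRing B'] [Module ℂ B'] [IsScalarTower ℂ B' B'] [SMulCommClass ℂ B' B']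
    (P : DualSemi.Independence.{u})
    (Δ : B →ₙₐ[ℂ] DualSemi.FreeProd B B) (Δ' : B' →ₙₐ[ℂ] DualSemi.FreeProd B' B')
    (coassoc : ∀ b, DualSemi.FreeProd.assoc B B B
        (DualSemi.FreeProd.map Δ (NonUnitalAlgHom.id ℂ B) (Δ b))
      = DualSemi.FreeProd.map (NonUnitalAlgHom.id ℂ B) Δ (Δ b))
    (counit_right : ∀ b,
      DualSemi.FreeProd.lift (NonUnitalAlgHom.id ℂ B) (0 : B →ₙₐ[ℂ] B) (Δ b) = b)
    (j : B' →ₙₐ[ℂ] B) (hj : ∀ x, DualSemi.FreeProd.map j j (Δ' x) = Δ (j x))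
    (φ₁ φ₂ ψ : B →ₗ[ℂ] ℂ) :
    DualSemi.conv P Δ' (φ₁ ∘ₗ (j : B' →ₗ[ℂ] B)) (φ₂ ∘ₗ (j : B' →ₗ[ℂ] B))
      = DualSemi.conv P Δ φ₁ φ₂ ∘ₗ (j : B' →ₗ[ℂ] B) ∧
    (∃! χ, DualSemi.IsConvExp P Δ ψ χ) ∧
    (∃! χ, DualSemi.IsConvExp P Δ' (ψ ∘ₗ (j : B' →ₗ[ℂ] B)) χ) ∧
    DualSemi.convExp P Δ' (ψ ∘ₗ (j : B' →ₗ[ℂ] B))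
      = DualSemi.convExp P Δ ψ ∘ₗ (j : B' →ₗ[ℂ] B) ∧
    (∀ x, j x = 0 → DualSemi.convExp P Δ' (ψ ∘ₗ (j : B' →ₗ[ℂ] B)) x = 0) := by
  obtain ⟨χ, hχ⟩ := DualSemi.exists_isConvExp P coassoc counit_right ψ
  have hχ' := hχ.comp j hj
  have convExp_comp : DualSemi.convExp P Δ' (ψ ∘ₗ (j : B' →ₗ[ℂ] B))
      = DualSemi.convExp P Δ ψ ∘ₗ (j : B' →ₗ[ℂ] B) := by
    rw [hχ'.convExp_eq, hχ.convExp_eq]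
  refine ⟨DualSemi.conv_comp φ₁ φ₂ j hj, ⟨χ, hχ, fun _ h => h.unique hχ⟩,
    ⟨_, hχ', fun _ h => h.unique hχ'⟩, convExp_comp, fun x hx => ?_⟩
  simp [convExp_comp, hx]

theorem mainTheorem6 {B : Type u} [NonUnitalRing B] [Module ℂ B] [IsScalarTower ℂ B B]
    [SMulCommClass ℂ B B] [StarRing B] [StarModule ℂ B]
    (P : DualSemi.Independence.{u})
    (Δ : B →ₙₐ[ℂ] DualSemi.FreeProd B B) (hΔ : DualSemi.IsDualSemigroup Δ)
    (φ₁ φ₂ ψ : B →ₗ[ℂ] ℂ) :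
    -- (a)
    DualSemi.conv P (DualSemi.tensorComul Δ)
        (φ₁ ∘ₗ (DualSemi.mulMap B : DualSemi.TAlg B →ₗ[ℂ] B))
        (φ₂ ∘ₗ (DualSemi.mulMap B : DualSemi.TAlg B →ₗ[ℂ] B))
      = DualSemi.conv P Δ φ₁ φ₂ ∘ₗ (DualSemi.mulMap B : DualSemi.TAlg B →ₗ[ℂ] B) ∧
    -- (b) both convolution exponentials are well defined, and they correspond
    (∃! χ, DualSemi.IsConvExp P Δ ψ χ) ∧
    (∃! χ, DualSemi.IsConvExp P (DualSemi.tensorComul Δ)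
      (ψ ∘ₗ (DualSemi.mulMap B : DualSemi.TAlg B →ₗ[ℂ] B)) χ) ∧
    DualSemi.convExp P (DualSemi.tensorComul Δ)
        (ψ ∘ₗ (DualSemi.mulMap B : DualSemi.TAlg B →ₗ[ℂ] B))
      = DualSemi.convExp P Δ ψ ∘ₗ (DualSemi.mulMap B : DualSemi.TAlg B →ₗ[ℂ] B) ∧
    -- (c) the kernel of `M` is a two-sided `*`-ideal, on which the exponential vanishes
    (∀ x : DualSemi.TAlg B, DualSemi.mulMap B x = 0 →
      DualSemi.mulMap B (star x) = 0 ∧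
        ∀ y : DualSemi.TAlg B, DualSemi.mulMap B (y * x) = 0 ∧ DualSemi.mulMap B (x * y) = 0) ∧
    (∀ x : DualSemi.TAlg B, DualSemi.mulMap B x = 0 →
      DualSemi.convExp P (DualSemi.tensorComul Δ)
        (ψ ∘ₗ (DualSemi.mulMap B : DualSemi.TAlg B →ₗ[ℂ] B)) x = 0) :=
  let ⟨conv_comp, exp, exp', exp_comp, exp_ker⟩ := mainTheorem6_general P Δ
    (DualSemi.tensorComul Δ) hΔ.coassoc hΔ.counit_right (DualSemi.mulMap B)
    (DualSemi.map_mulMap_tensorComul Δ) φ₁ φ₂ ψ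
  ⟨conv_comp, exp, exp', exp_comp,
    fun x hx => ⟨by simp [DualSemi.mulMap_star, hx], fun y => by simp [hx]⟩, exp_ker⟩
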